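/- Let $L$ be a positive definite even lattice of rank $d$ with form $(\cdot,\cdot)$, let $\mathfrak h=L\otimes_{\mathbb Z}\mathbb C$ carry the $\mathbb C$-bilinear extension of the form, and let $h_1,\dots,h_d$ be an orthonormal basis of $\mathfrak h$. Let $V_L=M(1)\otimes\mathbb C[L]$ be the lattice vertex operator algebra of $L$, with Heisenberg operators $h_i(n)$, vacuum $\mathbf 1$, Virasoro element $\omega=\frac12\sum_{i=1}^d h_i(-1)^2\mathbf 1$, $Y(\omega,z)=\sum_n L(n)z^{-n-2}$, central charge $d$, and $L(0)$-grading $V_L=\bigoplus_{n\in\mathbb Z}(V_L)_n$. Let $P\in\mathbb C[x_1,\dots,x_d]$ be a homogeneous spherical harmonic of degree $k$, i.e. $P$ is homogeneous of degree $k$ and $\sum_{i=1}^d\partial^2P/\partial x_i^2=0$. Put $$v_P=P(h_1(-1),\dots,h_d(-1))\mathbf 1\in V_L .$$ Then $v_P$ is a primary field of weight $k$: $L(0)v_P=k\,v_P$ and $L(n)v_P=0$ for all $n\ge 1$. Let $Y(v_P,z)=\sum_n v_P(n)z^{-n-1}$ and let $o(v_P)=v_P(k-1)$ be its zero mode. Each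 $(V_L)_n$ is finite-dimensional and preserved by $o(v_P)$, and for $q=e^{2\pi i\tau}$ with $\operatorname{Im}\tau>0$ the trace function of $v_P$ and the weighted theta series below converge absolutely, and $$Z(v_P,q)=q^{-d/24}\sum_{n\in\mathbb Z}\bigl(\operatorname{tr}_{(V_L)_n}o(v_P)\bigr)q^n=\frac{\theta_L(P,q)}{\eta(q)^d},$$ where $\theta_L(P,q)=\sum_{\alpha\in L}P\bigl((h_1,\alpha),\dots,(h_d,\alpha)\bigr)\,q^{(\alpha,\alpha)/2}$ and $\eta(q)=q^{1/24}\prod_{n\ge1}(1-q^n)$. -/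

import Mathlib

open scoped TensorProduct UpperHalfPlane

noncomputable section

namespace LatticeVOA

/-! ### Lattices and cocycles -/

section Lattice

variable {L : Type*} [AddCommGroup L]

/-- `B` is a positive definite, even, symmetric integral bilinear form, i.e. it makes a free abelian
group of finite rank `L` into a positive definite even lattice. -/
structure IsPosDefEven (B : LinearMap.BilinForm ℤ L) : Prop where
  symm : ∀ x y, B x y = B y x
  even : ∀ x, Even (B x x)
  pos : ∀ x, x ≠ 0 → 0 < B x x

/-- `ε` is a normalized `{±1}`-valued 2-cocycle on `L` whose commutator map is
`(α, β) ↦ (-1) ^ (α, β)`; it describes the twisted group algebra `ℂ{L}` through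
`e^α * e^β = ε α β • e^(α + β)`. -/
structure IsCocycle (B : LinearMap.BilinForm ℤ L) (ε : L → L → ℤˣ) : Prop where
  zero_left : ∀ α, ε 0 α = 1
  zero_right : ∀ α, ε α 0 = 1
  cocycle : ∀ α β γ, ε α β * ε (α + β) γ = ε β γ * ε α (β + γ)
  comm : ∀ α β, ε α β * ε β α = (-1 : ℤˣ) ^ (B α β)

/-- Every even lattice has such a cocycle. -/
theorem exists_isCocycle [Module.Free ℤ L] {B : LinearMap.BilinForm ℤ L} (hB : IsPosDefEven B) :
    ∃ ε, IsCocycle B ε := by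
  classical
  choose q hq using fun x => hB.even x
  let Q : QuadraticMap ℤ L ℤ :=
    { toFun := q
      toFun_smul := fun a x => by
        have h1 := hq (a • x)
        have h2 := hq x
        simp only [map_smul, LinearMap.smul_apply, smul_eq_mul] at h1 ⊢
        rw [h2] at h1
        linarith
      exists_companion' := ⟨B, fun x y => by
        have h1 := hq (x + y)
        have h2 := hq x
        have h3 := hq y
        have h4 := hB.symm x y
        simp only [map_add, LinearMap.add_apply] at h1
        linarith⟩ }
  obtain ⟨A, hA⟩ := LinearMap.BilinMap.toQuadraticMap_surjective (R := ℤ) (M := L) (N := ℤ) Q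
  have hA' : ∀ x, A x x = q x := fun x => congrArg (fun F : QuadraticMap ℤ L ℤ => F x) hA
  refine ⟨fun x y => (-1) ^ (A x y), ?_, ?_, ?_, ?_⟩
  · simp
  · simp
  · intro x y z
    simp only [map_add, LinearMap.add_apply, zpow_add]
    rw [← mul_assoc, mul_comm]
  · intro x y
    simp only [← zpow_add]
    congr 1
    have h0 := hA' (x + y)
    simp only [map_add, LinearMap.add_apply, hA'] at h0
    have h1 := hq (x + y)
    have h2 := hq x
    have h3 := hq y
    have h4 := hB.symm x y
    simp only [map_add, LinearMap.add_apply] at h1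
    linarith

end Lattice

/-! ### Fields -/

section Fields

variable {V : Type*} [AddCommGroup V] [Module ℂ V]

/-- The field `∑ n, f n z ^ (-n - 1)` with given modes `f n`, where on every vector only finitely
many modes of positive index are nonzero. -/
def ofModes (f : ℤ → Module.End ℂ V) (hf : ∀ x, ∃ N : ℤ, ∀ n, N ≤ n → f n x = 0) :
    VertexOperator ℂ V :=
  VertexOperator.of_coeff (fun m => f (-m - 1)) (fun x => by
    obtain ⟨N, hN⟩ := hf x
    refine ⟨-N, fun m hm => ?_⟩
    by_contra hlt
    exact hm (hN _ (by omega)))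

theorem ncoeff_ofModes (f : ℤ → Module.End ℂ V)
    (hf : ∀ x, ∃ N : ℤ, ∀ n, N ≤ n → f n x = 0) (n : ℤ) : (ofModes f hf).ncoeff n = f n := by
  rw [ofModes, VertexOperator.ncoeff_of_coeff]
  congr 1
  ring

theorem exists_ncoeff_eq_zero (A : VertexOperator ℂ V) (x : V) :
    ∃ N : ℤ, ∀ n, N ≤ n → A.ncoeff n x = 0 := by
  refine ⟨-((HahnModule.of ℂ).symm (A x)).order, fun n hn => ?_⟩
  exact VertexOperator.ncoeff_eq_zero_of_lt_order A n x (by omega)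

theorem finite_left (A C : VertexOperator ℂ V) (n : ℤ) (x : V) :
    (Function.support fun j : ℕ => A.ncoeff (-(j : ℤ) - 1) (C.ncoeff (n + j) x)).Finite := by
  obtain ⟨N, hN⟩ := exists_ncoeff_eq_zero C x
  refine (Set.finite_lt_nat (N - n).toNat).subset fun j hj => ?_
  by_contra hlt
  refine hj ?_
  simp only [Set.mem_ofPred_eq, not_lt] at hlt
  simp only [hN (n + j) (by omega), map_zero]

theorem finite_right (A C : VertexOperator ℂ V) (n : ℤ) (x : V) :
    (Function.support fun j : ℕ => C.ncoeff (n - j - 1) (A.ncoeff (j : ℤ) x)).Finite := by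
  obtain ⟨N, hN⟩ := exists_ncoeff_eq_zero A x
  refine (Set.finite_lt_nat N.toNat).subset fun j hj => ?_
  by_contra hlt
  refine hj ?_
  simp only [Set.mem_ofPred_eq, not_lt] at hlt
  simp only [hN j (by omega), map_zero]

/-- The modes of the normally ordered product of two fields:
`(:AC:)(n) = ∑_{j < 0} A(j) C(n - j - 1) + ∑_{j ≥ 0} C(n - j - 1) A(j)`,
a finite sum on every vector. -/
def normalOrderMode (A C : VertexOperator ℂ V) (n : ℤ) : Module.End ℂ V where
  toFun x := (∑ᶠ j : ℕ, A.ncoeff (-(j : ℤ) - 1) (C.ncoeff (n + j) x)) +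
    ∑ᶠ j : ℕ, C.ncoeff (n - j - 1) (A.ncoeff (j : ℤ) x)
  map_add' x y := by
    simp only [map_add]
    rw [finsum_add_distrib (finite_left A C n x) (finite_left A C n y),
      finsum_add_distrib (finite_right A C n x) (finite_right A C n y)]
    abel
  map_smul' c x := by
    simp only [map_smul, RingHom.id_apply, smul_add]
    rw [smul_finsum, smul_finsum]

/-- The normally ordered product `:A(z) C(z):` of two fields. -/
def normalOrder (A C : VertexOperator ℂ V) : VertexOperator ℂ V :=
  ofModes (normalOrderMode A C) (fun x => by
    obtain ⟨N, hN⟩ := exists_ncoeff_eq_zero C x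
    obtain ⟨M, hM⟩ := exists_ncoeff_eq_zero A x
    choose K hK using fun j : ℕ => exists_ncoeff_eq_zero C (A.ncoeff (j : ℤ) x)
    obtain ⟨T, hT⟩ := ((Finset.range M.toNat).image fun j => K j + j + 1).exists_le
    refine ⟨max N T, fun n hn => ?_⟩
    have h1 : ∀ j : ℕ, A.ncoeff (-(j : ℤ) - 1) (C.ncoeff (n + j) x) = 0 := fun j => by
      rw [hN (n + j) (by have := le_max_left N T; omega), map_zero]
    have h2 : ∀ j : ℕ, C.ncoeff (n - j - 1) (A.ncoeff (j : ℤ) x) = 0 := fun j => by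
      by_cases hj : j < M.toNat
      · have := hT _ (Finset.mem_image_of_mem (fun j : ℕ => K j + j + 1) (Finset.mem_range.2 hj))
        exact hK j _ (by have := le_max_right N T; omega)
      · rw [hM j (by omega), map_zero]
    simp [normalOrderMode, h1, h2])

end Fields

/-! ### The lattice vertex operator algebra -/

/-- The Fock space `M(1) = S(𝔥 ⊗ t⁻¹ℂ[t⁻¹])`, as the polynomial algebra in the variables
`X (i, r) = h_i(-(r + 1))`, where `h_1, …, h_d` is an orthonormal basis of `𝔥`. -/
abbrev Fock (d : ℕ) : Type := MvPolynomial (Fin d × ℕ) ℂ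

/-- The space `V_L = M(1) ⊗ ℂ[L]`; the vector `u ⊗ e^α` is `Finsupp.single α u`. -/
abbrev Space (L : Type*) (d : ℕ) : Type _ := L →₀ Fock d

section Construction

variable {L : Type*} [AddCommGroup L] {d : ℕ}

/-- The complex number `(h_i, α)` for `α ∈ L`, where `𝔥 = ℂ ⊗ L` carries the `ℂ`-bilinear
extension of `B`. -/
def pairing (B : LinearMap.BilinForm ℤ L) (h : Fin d → ℂ ⊗[ℤ] L) (i : Fin d) (α : L) : ℂ :=
  B.baseChange ℂ (h i) (1 ⊗ₜ[ℤ] α)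

/-- The Heisenberg operators `h_i(n)` on `V_L`: for `n = -(r + 1) < 0` multiplication by the
variable `h_i(-(r + 1))`, for `n = 0` multiplication by `(h_i, α)` on `M(1) ⊗ e^α`, and for
`n = r + 1 > 0` the derivation `(r + 1) ∂ / ∂ h_i(-(r + 1))`. -/
def heis (B : LinearMap.BilinForm ℤ L) (h : Fin d → ℂ ⊗[ℤ] L) (i : Fin d) :
    ℤ → Module.End ℂ (Space L d)
  | Int.negSucc r => Finsupp.mapRange.linearMap (LinearMap.mulLeft ℂ (MvPolynomial.X (i, r)))
  | Int.ofNat 0 => Finsupp.lsum ℂ fun α => pairing B h i α • Finsupp.lsingle α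
  | Int.ofNat (r + 1) => Finsupp.mapRange.linearMap
      (((r : ℂ) + 1) • (MvPolynomial.pderiv (R := ℂ) (i, r)).toLinearMap)

theorem heis_truncated (B : LinearMap.BilinForm ℤ L) (h : Fin d → ℂ ⊗[ℤ] L) (i : Fin d)
    (x : Space L d) : ∃ N : ℤ, ∀ n, N ≤ n → heis B h i n x = 0 := by
  induction x using Finsupp.induction_linear with
  | zero => exact ⟨0, fun n _ => map_zero _⟩
  | add x y hx hy =>
    obtain ⟨N, hN⟩ := hx
    obtain ⟨M, hM⟩ := hy
    exact ⟨max N M, fun n hn => by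
      rw [map_add, hN n (le_trans (le_max_left _ _) hn), hM n (le_trans (le_max_right _ _) hn),
        add_zero]⟩
  | single α f =>
    obtain ⟨T, hT⟩ := (f.vars.image fun s => s.2).exists_le
    refine ⟨T + 2, fun n hn => ?_⟩
    obtain ⟨r, rfl⟩ : ∃ r : ℕ, n = Int.ofNat (r + 1) := ⟨(n - 1).toNat, by
      simp only [Int.ofNat_eq_natCast]; omega⟩
    have hr : (i, r) ∉ f.vars := fun hmem => by
      have := hT _ (Finset.mem_image_of_mem (fun s : Fin d × ℕ => s.2) hmem)
      simp only [Int.ofNat_eq_natCast] at hn this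
      omega
    simp [heis, MvPolynomial.pderiv_eq_zero_of_notMem_vars hr]

/-- The field `∂^(r) h_i(z)`, where `h_i(z) = ∑ n, h_i(n) z ^ (-n - 1)` and
`∂^(r) = (1 / r!) (d / dz) ^ r`. Its `m`-th mode, the coefficient of `z ^ (-m - 1)`, is
`(r - m - 1 choose r) h_i(m - r)`. -/
def heisField (B : LinearMap.BilinForm ℤ L) (h : Fin d → ℂ ⊗[ℤ] L) (s : Fin d × ℕ) :
    VertexOperator ℂ (Space L d) :=
  ofModes (fun m => ((Ring.choose ((s.2 : ℤ) - m - 1) s.2 : ℤ) : ℂ) • heis B h s.1 (m - s.2))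
    (fun x => by
      obtain ⟨N, hN⟩ := heis_truncated B h s.1 x
      exact ⟨N + s.2, fun n hn => by
        rw [LinearMap.smul_apply, hN _ (by omega), smul_zero]⟩)

/-- `exp (∑_{n ≥ 1} α(-n) z ^ n / n)`, a power series with coefficients in `M(1)`, where
`α(-n) = ∑ i, (h_i, α) h_i(-n)`. -/
def expCreation (B : LinearMap.BilinForm ℤ L) (h : Fin d → ℂ ⊗[ℤ] L) (α : L) :
    PowerSeries (Fock d) :=
  (PowerSeries.exp (Fock d)).subst (PowerSeries.mk fun n : ℕ => match n with
    | 0 => (0 : Fock d)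
    | r + 1 => ∑ i, MvPolynomial.C (pairing B h i α / ((r : ℂ) + 1)) * MvPolynomial.X (i, r))

/-- `exp (-∑_{n ≥ 1} α(n) z ^ (-n) / n)`. Since `α(n) / n = ∑ i, (h_i, α) ∂ / ∂ h_i(-n)`, it is the
substitution `h_i(-n) ↦ h_i(-n) - (h_i, α) z ^ (-n)`. -/
def expAnnihilation (B : LinearMap.BilinForm ℤ L) (h : Fin d → ℂ ⊗[ℤ] L) (α : L) :
    Fock d →+* LaurentSeries (Fock d) :=
  MvPolynomial.eval₂Hom (HahnSeries.C.comp MvPolynomial.C) fun s : Fin d × ℕ =>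
    HahnSeries.single (0 : ℤ) (MvPolynomial.X s : Fock d) -
      HahnSeries.single (-((s.2 : ℤ) + 1)) (MvPolynomial.C (pairing B h s.1 α))

/-- The Laurent series `u(z)` with `Y(e^α, z) (f ⊗ e^β) = u(z) ⊗ e^(α + β)`, that is
`u(z) = ε(α, β) z^(α, β) exp (∑ α(-n) z ^ n / n) exp (-∑ α(n) z ^ (-n) / n) f`. -/
def expSeries (B : LinearMap.BilinForm ℤ L) (ε : L → L → ℤˣ) (h : Fin d → ℂ ⊗[ℤ] L) (α β : L)
    (f : Fock d) : LaurentSeries (Fock d) :=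
  HahnSeries.single (B α β) (((ε α β : ℤ) : Fock d)) *
    ((expCreation B h α : PowerSeries (Fock d)) : LaurentSeries (Fock d)) *
    expAnnihilation B h α f

theorem expSeries_add (B : LinearMap.BilinForm ℤ L) (ε : L → L → ℤˣ) (h : Fin d → ℂ ⊗[ℤ] L)
    (α β : L) (f g : Fock d) :
    expSeries B ε h α β (f + g) = expSeries B ε h α β f + expSeries B ε h α β g := by
  simp only [expSeries, map_add, mul_add]

theorem expSeries_smul (B : LinearMap.BilinForm ℤ L) (ε : L → L → ℤˣ) (h : Fin d → ℂ ⊗[ℤ] L)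
    (α β : L) (c : ℂ) (f : Fock d) :
    expSeries B ε h α β (c • f) = HahnSeries.C (MvPolynomial.C c) * expSeries B ε h α β f := by
  simp only [expSeries, expAnnihilation, MvPolynomial.smul_eq_C_mul, map_mul,
    MvPolynomial.coe_eval₂Hom, MvPolynomial.eval₂_C, RingHom.comp_apply]
  ring

/-- The coefficient of `z ^ n` in `expSeries`, as a linear map. -/
def expCoeff (B : LinearMap.BilinForm ℤ L) (ε : L → L → ℤˣ) (h : Fin d → ℂ ⊗[ℤ] L) (α β : L)
    (n : ℤ) : Fock d →ₗ[ℂ] Fock d where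
  toFun f := (expSeries B ε h α β f).coeff n
  map_add' f g := by rw [expSeries_add, HahnSeries.coeff_add]
  map_smul' c f := by
    rw [expSeries_smul, HahnSeries.C_mul_eq_smul, HahnSeries.coeff_smul, smul_eq_mul,
      ← MvPolynomial.smul_eq_C_mul, RingHom.id_apply]

/-- The modes of `Y(e^α, z)`. -/
def expMode (B : LinearMap.BilinForm ℤ L) (ε : L → L → ℤˣ) (h : Fin d → ℂ ⊗[ℤ] L) (α : L) (n : ℤ) :
    Module.End ℂ (Space L d) :=
  Finsupp.lsum ℂ fun β => Finsupp.lsingle (α + β) ∘ₗ expCoeff B ε h α β (-n - 1)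

/-- The vertex operator `Y(e^α, z)`. -/
def expField (B : LinearMap.BilinForm ℤ L) (ε : L → L → ℤˣ) (h : Fin d → ℂ ⊗[ℤ] L) (α : L) :
    VertexOperator ℂ (Space L d) :=
  ofModes (expMode B ε h α) (fun x => by
    induction x using Finsupp.induction_linear with
    | zero => exact ⟨0, fun n _ => map_zero _⟩
    | add x y hx hy =>
      obtain ⟨N, hN⟩ := hx
      obtain ⟨M, hM⟩ := hy
      exact ⟨max N M, fun n hn => by
        rw [map_add, hN n (le_trans (le_max_left _ _) hn), hM n (le_trans (le_max_right _ _) hn),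
          add_zero]⟩
    | single β f =>
      refine ⟨-(expSeries B ε h α β f).order, fun n hn => ?_⟩
      have hlt : -n - 1 < (expSeries B ε h α β f).order := by linarith
      have : expCoeff B ε h α β (-n - 1) f = 0 := HahnSeries.coeff_eq_zero_of_lt_order hlt
      rw [expMode, Finsupp.lsum_single, LinearMap.comp_apply, this, map_zero])

/-- The vertex operator of `u ⊗ e^α` for a monomial `u = h_{i_1}(-r_1 - 1) ⋯ h_{i_k}(-r_k - 1)`,
with exponents `μ`: it is `:∂^(r_1) h_{i_1}(z) ⋯ ∂^(r_k) h_{i_k}(z) Y(e^α, z):`. -/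
def monomialField (B : LinearMap.BilinForm ℤ L) (ε : L → L → ℤˣ) (h : Fin d → ℂ ⊗[ℤ] L) (α : L)
    (μ : Fin d × ℕ →₀ ℕ) : VertexOperator ℂ (Space L d) :=
  (Finsupp.toMultiset μ).toList.foldr (fun s A => normalOrder (heisField B h s) A)
    (expField B ε h α)

/-- The state-field correspondence `v ↦ Y(v, z)` of `V_L`. -/
def Y (B : LinearMap.BilinForm ℤ L) (ε : L → L → ℤˣ) (h : Fin d → ℂ ⊗[ℤ] L) :
    Space L d →ₗ[ℂ] VertexOperator ℂ (Space L d) :=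
  Finsupp.lsum ℂ fun α =>
    (MvPolynomial.basisMonomials (Fin d × ℕ) ℂ).constr ℂ (monomialField B ε h α)

/-- The Virasoro element `ω = (1 / 2) ∑ i, h_i(-1) ^ 2 𝟏`. -/
def omega (L : Type*) [AddCommGroup L] (d : ℕ) : Space L d :=
  Finsupp.single 0 (MvPolynomial.C (1 / 2) * ∑ i, MvPolynomial.X (i, 0) ^ 2)

/-- The Virasoro operators, `Y(ω, z) = ∑ n, L(n) z ^ (-n - 2)`. -/
def virasoro (B : LinearMap.BilinForm ℤ L) (ε : L → L → ℤˣ) (h : Fin d → ℂ ⊗[ℤ] L) (n : ℤ) :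
    Module.End ℂ (Space L d) :=
  (Y B ε h (omega L d)).ncoeff (n + 1)

/-- The homogeneous subspace `V_n`, the eigenspace of `L(0)` with eigenvalue `n`. -/
def weightSpace (B : LinearMap.BilinForm ℤ L) (ε : L → L → ℤˣ) (h : Fin d → ℂ ⊗[ℤ] L) (n : ℤ) :
    Submodule ℂ (Space L d) :=
  Module.End.eigenspace (virasoro B ε h 0) (n : ℂ)

/-- `v` is a primary field of weight `k`: it is homogeneous of weight `k`, and a highest weight
vector for the Virasoro algebra. -/
def IsPrimary (B : LinearMap.BilinForm ℤ L) (ε : L → L → ℤˣ) (h : Fin d → ℂ ⊗[ℤ] L) (k : ℤ)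
    (v : Space L d) : Prop :=
  v ∈ weightSpace B ε h k ∧ ∀ n : ℤ, 0 < n → virasoro B ε h n v = 0

/-- The zero mode `o(v) = v(k - 1)` of a vector `v` of weight `k`. -/
def zeroMode (B : LinearMap.BilinForm ℤ L) (ε : L → L → ℤˣ) (h : Fin d → ℂ ⊗[ℤ] L) (k : ℤ)
    (v : Space L d) : Module.End ℂ (Space L d) :=
  (Y B ε h v).ncoeff (k - 1)

/-- The trace function `Z(v, q) = tr_V o(v) q ^ (L(0) - c / 24) = ∑ n, (tr_{V_n} o(v)) q ^ (n - c / 24)`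
of a vector `v` of weight `k`, where the central charge is `c = d` and `q = exp (2 π i τ)`, is
defined (the spaces `V_n` have finite dimension and are preserved by `o(v)`), converges absolutely
on the upper half-plane, and its sum there is `Z`. -/
def HasTraceFunction (B : LinearMap.BilinForm ℤ L) (ε : L → L → ℤˣ) (h : Fin d → ℂ ⊗[ℤ] L) (k : ℤ)
    (v : Space L d) (Z : ℍ → ℂ) : Prop :=
  (∀ n : ℤ, FiniteDimensional ℂ (weightSpace B ε h n)) ∧
  ∃ hpres : ∀ n : ℤ, ∀ x ∈ weightSpace B ε h n, zeroMode B ε h k v x ∈ weightSpace B ε h n,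
    ∀ τ : ℍ, HasSum
      (fun n : ℤ => LinearMap.trace ℂ (weightSpace B ε h n)
          ((zeroMode B ε h k v).restrict (hpres n)) *
        Complex.exp (2 * Real.pi * Complex.I * (τ : ℂ) * ((n : ℂ) - (d : ℂ) / 24)))
      (Z τ)

/-- The general term `P(α) q ^ ((α, α) / 2)` of the theta series of `L` weighted by `P`, where
`P(α) = P((h_1, α), …, (h_d, α))`. -/
def thetaTerm (B : LinearMap.BilinForm ℤ L) (h : Fin d → ℂ ⊗[ℤ] L) (P : MvPolynomial (Fin d) ℂ)
    (τ : ℍ) (α : L) : ℂ :=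
  MvPolynomial.eval (fun i => pairing B h i α) P *
    Complex.exp (2 * Real.pi * Complex.I * (τ : ℂ) * ((B α α : ℂ) / 2))

/-- The theta series `θ_L(P, τ) = ∑_{α ∈ L} P(α) q ^ ((α, α) / 2)`. -/
def theta (B : LinearMap.BilinForm ℤ L) (h : Fin d → ℂ ⊗[ℤ] L) (P : MvPolynomial (Fin d) ℂ)
    (τ : ℍ) : ℂ :=
  ∑' α : L, thetaTerm B h P τ α

/-- The vector `v_P = P(h_1(-1), …, h_d(-1)) 𝟏`. -/
def vec (L : Type*) [AddCommGroup L] (P : MvPolynomial (Fin d) ℂ) : Space L d :=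
  Finsupp.single 0 (MvPolynomial.aeval (fun i => (MvPolynomial.X (i, 0) : Fock d)) P)

end Construction

end LatticeVOA

end

/-!
The trace of the zero mode of `v_P` over `V_n` is computed on the blocks `M(1)_N ⊗ e^α`, which
span `V_n` for `(α, α) / 2 + N = n`. The claim there is
`tr o(v_Q) = Q(α) dim M(1)_N` for every harmonic `Q` (`blockTrace_zeroMode`), and it is proved by
induction on the degree. Euler's identity writes `(deg Q) Q = ∑_i x_i ∂_i Q`, and
`Y(v_{x_i R}, z)` is the normally ordered product of `h_i(z)` and `Y(v_R, z)`
(`polyField_X_mul`), so the zero mode of `v_Q` splits into three kinds of terms. Those with `h_i(0)`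
give `(h_i, α) tr o(v_{∂_i Q})`, where `∂_i Q` is again harmonic. Those with a creation operator
`h_i(-n)` or an annihilation operator `h_i(n)` are moved around by cyclicity of the trace, which
replaces the weight `N` by `N - n` at the cost of the commutator
`[h_i(m), v_R(p)] = m v_{∂_i R}(p + m - 1)` (`heis_polyField_commutator`). Summed over `i` the
commutators add up to a mode of `v_{ΔQ} = 0`, so these terms do not change when `N` is replaced by
`N - n`, and therefore vanish because `M(1)_N = 0` for `N < 0` (`sum_blockTrace_heis_eq_zero`).

Since `h^μ ⊗ e^α` is an eigenvector of `L(0)` (`virasoro_zero_spaceBasis`), the trace function is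
then a double series over `α ∈ L` and monomials `h^μ`, which factors into the theta series and the
character `∑_μ q ^ wt μ = ∏_n (1 - q ^ n) ^ (-d)` of the Fock space (`hasSum_pow_wt`). The theta
series converges because the lattice has orthogonal coordinates over `ℚ`
(`exists_orthogonal_vectors`), in which it is dominated by products of one-variable Gaussian sums
(`summable_thetaTerm`). That `v_P` is primary follows from the explicit modes of `ω`: only `L(2)`
meets the Laplacian, through `L(2) v_P = v_{ΔP} / 2` (`virasoro_pos_vec`).
-/

open scoped TensorProduct UpperHalfPlane

namespace LatticeVOA

/-! ### Normally ordered products -/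

section NormalOrder

variable {V : Type*} [AddCommGroup V] [Module ℂ V]

theorem ncoeff_ext {A C : VertexOperator ℂ V} (hAC : ∀ n x, A.ncoeff n x = C.ncoeff n x) :
    A = C := by
  apply HVertexOperator.coeff_inj
  funext m
  rw [VertexOperator.coeff_eq_ncoeff, VertexOperator.coeff_eq_ncoeff]
  exact LinearMap.ext (hAC _)

theorem ncoeff_add_apply (A C : VertexOperator ℂ V) (n : ℤ) (x : V) :
    (A + C).ncoeff n x = A.ncoeff n x + C.ncoeff n x := by
  rw [map_add]
  rfl

theorem ncoeff_smul_apply (c : ℂ) (A : VertexOperator ℂ V) (n : ℤ) (x : V) :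
    (c • A).ncoeff n x = c • A.ncoeff n x := by
  rw [map_smul]
  rfl

theorem ncoeff_normalOrder (A C : VertexOperator ℂ V) (n : ℤ) :
    (normalOrder A C).ncoeff n = normalOrderMode A C n :=
  ncoeff_ofModes _ _ _

/-- The two series defining a mode of a normally ordered product can be cut off at the same
place, uniformly for all modes of index bounded below. -/
theorem eventually_normalOrder (A C : VertexOperator ℂ V) (n₀ : ℤ) (x : V) :
    ∀ᶠ M : ℕ in Filter.atTop, ∀ n, n₀ ≤ n → (normalOrder A C).ncoeff n x =
      ∑ j ∈ Finset.range M, (A.ncoeff (-(j : ℤ) - 1) (C.ncoeff (n + j) x) +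
        C.ncoeff (n - j - 1) (A.ncoeff (j : ℤ) x)) := by
  obtain ⟨N, hN⟩ := exists_ncoeff_eq_zero C x
  obtain ⟨K, hK⟩ := exists_ncoeff_eq_zero A x
  filter_upwards [Filter.eventually_ge_atTop (max (N - n₀).toNat K.toNat)] with M hM n hn
  have h1 := (le_max_left _ _).trans hM
  have h2 := (le_max_right _ _).trans hM
  rw [ncoeff_normalOrder, Finset.sum_add_distrib]
  simp only [normalOrderMode, LinearMap.coe_mk, AddHom.coe_mk]
  congr 1
  · refine finsum_eq_sum_of_support_subset _ fun j hj => ?_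
    by_contra hlt
    refine hj ?_
    simp only [Finset.coe_range, Set.mem_Iio, not_lt] at hlt
    simp only [hN (n + j) (by omega), map_zero]
  · refine finsum_eq_sum_of_support_subset _ fun j hj => ?_
    by_contra hlt
    refine hj ?_
    simp only [Finset.coe_range, Set.mem_Iio, not_lt] at hlt
    simp only [hK j (by omega), map_zero]

theorem eventually_normalOrder_apply (A C : VertexOperator ℂ V) (n : ℤ) (x : V) :
    ∀ᶠ M : ℕ in Filter.atTop, (normalOrder A C).ncoeff n x =
      ∑ j ∈ Finset.range M, (A.ncoeff (-(j : ℤ) - 1) (C.ncoeff (n + j) x) +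
        C.ncoeff (n - j - 1) (A.ncoeff (j : ℤ) x)) :=
  (eventually_normalOrder A C n x).mono fun _ hM => hM n le_rfl

theorem normalOrder_add_right (A C D : VertexOperator ℂ V) :
    normalOrder A (C + D) = normalOrder A C + normalOrder A D := by
  refine ncoeff_ext fun n x => ?_
  obtain ⟨M, h1, h2, h3⟩ := ((eventually_normalOrder_apply A (C + D) n x).and
    ((eventually_normalOrder_apply A C n x).and (eventually_normalOrder_apply A D n x))).exists
  rw [h1, ncoeff_add_apply, h2, h3, ← Finset.sum_add_distrib]
  refine Finset.sum_congr rfl fun j _ => ?_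
  simp only [ncoeff_add_apply]
  rw [map_add]
  abel

theorem normalOrder_smul_right (A C : VertexOperator ℂ V) (c : ℂ) :
    normalOrder A (c • C) = c • normalOrder A C := by
  refine ncoeff_ext fun n x => ?_
  obtain ⟨M, h1, h2⟩ := ((eventually_normalOrder_apply A (c • C) n x).and
    (eventually_normalOrder_apply A C n x)).exists
  rw [h1, ncoeff_smul_apply, h2, Finset.smul_sum]
  refine Finset.sum_congr rfl fun j _ => ?_
  simp only [ncoeff_smul_apply]
  rw [map_smul, smul_add]

/-- Nested normally ordered products `:A:A'C::` and `:A':AC::` agree as soon as the creation parts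
of `A` and `A'` commute and so do their annihilation parts. -/
theorem normalOrder_left_comm (A A' C : VertexOperator ℂ V)
    (hneg : ∀ a b : ℕ, ∀ x, A.ncoeff (-(a : ℤ) - 1) (A'.ncoeff (-(b : ℤ) - 1) x) =
      A'.ncoeff (-(b : ℤ) - 1) (A.ncoeff (-(a : ℤ) - 1) x))
    (hnonneg : ∀ a b : ℕ, ∀ x, A.ncoeff (a : ℤ) (A'.ncoeff (b : ℤ) x) =
      A'.ncoeff (b : ℤ) (A.ncoeff (a : ℤ) x)) :
    normalOrder A (normalOrder A' C) = normalOrder A' (normalOrder A C) := by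
  -- Both sides are cut off at a common `M` and become symmetric double sums.
  have key : ∀ (A A' : VertexOperator ℂ V) (n : ℤ) (x : V), ∀ᶠ M : ℕ in Filter.atTop,
      (normalOrder A (normalOrder A' C)).ncoeff n x =
        ∑ a ∈ Finset.range M, ∑ b ∈ Finset.range M,
          (A.ncoeff (-(a : ℤ) - 1) (A'.ncoeff (-(b : ℤ) - 1) (C.ncoeff (n + a + b) x)) +
            A.ncoeff (-(a : ℤ) - 1) (C.ncoeff (n + a - b - 1) (A'.ncoeff (b : ℤ) x)) +
            A'.ncoeff (-(b : ℤ) - 1) (C.ncoeff (n - a - 1 + b) (A.ncoeff (a : ℤ) x)) +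
            C.ncoeff (n - a - 1 - b - 1) (A'.ncoeff (b : ℤ) (A.ncoeff (a : ℤ) x))) := by
    intro A A' n x
    obtain ⟨K, hK⟩ := exists_ncoeff_eq_zero A x
    have h3 : ∀ᶠ M : ℕ in Filter.atTop, ∀ a ∈ Finset.range K.toNat,
        (normalOrder A' C).ncoeff (n - a - 1) (A.ncoeff (a : ℤ) x) =
        ∑ j ∈ Finset.range M,
          (A'.ncoeff (-(j : ℤ) - 1) (C.ncoeff (n - a - 1 + j) (A.ncoeff (a : ℤ) x)) +
            C.ncoeff (n - a - 1 - j - 1) (A'.ncoeff (j : ℤ) (A.ncoeff (a : ℤ) x))) :=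
      (Filter.eventually_all_finset _).2 fun a _ => eventually_normalOrder_apply _ _ _ _
    filter_upwards [eventually_normalOrder_apply A (normalOrder A' C) n x,
      eventually_normalOrder A' C n x, h3] with M h1 h2 h3
    rw [h1]
    refine Finset.sum_congr rfl fun a _ => ?_
    rw [h2 (n + a) (by omega)]
    have h4 : (normalOrder A' C).ncoeff (n - a - 1) (A.ncoeff (a : ℤ) x) =
        ∑ j ∈ Finset.range M,
          (A'.ncoeff (-(j : ℤ) - 1) (C.ncoeff (n - a - 1 + j) (A.ncoeff (a : ℤ) x)) +
            C.ncoeff (n - a - 1 - j - 1) (A'.ncoeff (j : ℤ) (A.ncoeff (a : ℤ) x))) := by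
      by_cases ha : a ∈ Finset.range K.toNat
      · exact h3 a ha
      · rw [Finset.mem_range] at ha
        rw [hK a (by omega)]
        simp
    rw [h4, map_sum, ← Finset.sum_add_distrib]
    refine Finset.sum_congr rfl fun b _ => ?_
    rw [map_add]
    abel
  refine ncoeff_ext fun n x => ?_
  obtain ⟨M, h1, h2⟩ := ((key A A' n x).and (key A' A n x)).exists
  rw [h1, h2, Finset.sum_comm]
  refine Finset.sum_congr rfl fun b _ => Finset.sum_congr rfl fun a _ => ?_
  rw [hneg, hnonneg, show n + (a : ℤ) + b = n + b + a by ring,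
    show n + (a : ℤ) - b - 1 = n - b - 1 + a by ring,
    show n - (a : ℤ) - 1 + b = n + b - a - 1 by ring,
    show n - (a : ℤ) - 1 - b - 1 = n - b - 1 - a - 1 by ring]
  abel

end NormalOrder

/-! ### Heisenberg operators -/

open MvPolynomial in
theorem pderiv_comm {σ : Type*} (a b : σ) (f : MvPolynomial σ ℂ) :
    pderiv a (pderiv b f) = pderiv b (pderiv a f) := by
  rcases eq_or_ne a b with rfl | hab
  · rfl
  ext m
  simp only [coeff_pderiv, Finsupp.add_apply, Finsupp.single_eq_of_ne hab,
    Finsupp.single_eq_of_ne hab.symm, add_zero]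
  rw [add_right_comm]
  ring

section Heisenberg

variable {L : Type*} [AddCommGroup L] {d : ℕ}
variable (B : LinearMap.BilinForm ℤ L) (h : Fin d → ℂ ⊗[ℤ] L)

theorem heis_neg_single (i : Fin d) (r : ℕ) (α : L) (f : Fock d) :
    heis B h i (-(r : ℤ) - 1) (Finsupp.single α f) =
      Finsupp.single α (MvPolynomial.X (i, r) * f) := by
  rw [show -(r : ℤ) - 1 = Int.negSucc r by omega]
  simp [heis]

theorem heis_zero_single (i : Fin d) (α : L) (f : Fock d) :
    heis B h i 0 (Finsupp.single α f) = Finsupp.single α (pairing B h i α • f) := by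
  change heis B h i (Int.ofNat 0) _ = _
  simp [heis]

theorem heis_pos_single (i : Fin d) (r : ℕ) (α : L) (f : Fock d) :
    heis B h i ((r : ℤ) + 1) (Finsupp.single α f) =
      Finsupp.single α (((r : ℂ) + 1) • MvPolynomial.pderiv (i, r) f) := by
  change heis B h i (Int.ofNat (r + 1)) _ = _
  simp [heis]

theorem int_cases (m : ℤ) : (∃ r : ℕ, m = -(r : ℤ) - 1) ∨ m = 0 ∨ ∃ r : ℕ, m = (r : ℤ) + 1 := by
  rcases lt_trichotomy m 0 with hm | hm | hm
  · exact Or.inl ⟨(-m - 1).toNat, by omega⟩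
  · exact Or.inr (Or.inl hm)
  · exact Or.inr (Or.inr ⟨(m - 1).toNat, by omega⟩)

/-- The canonical commutation relations `[h_i(m), h_j(n)] = m δ_{i,j} δ_{m+n,0}`. -/
theorem heis_commutator (i j : Fin d) (m n : ℤ) (x : Space L d) :
    heis B h i m (heis B h j n x) = heis B h j n (heis B h i m x) +
      (if i = j ∧ m + n = 0 then (m : ℂ) else 0) • x := by
  classical
  induction x using Finsupp.induction_linear with
  | zero => simp
  | add x y hx hy =>
    simp only [map_add, smul_add, hx, hy]
    abel
  | single α f =>
    rcases int_cases m with ⟨r, rfl⟩ | rfl | ⟨r, rfl⟩ <;>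
      rcases int_cases n with ⟨s, rfl⟩ | rfl | ⟨s, rfl⟩
    · have h1 : ¬(i = j ∧ -(r : ℤ) - 1 + (-(s : ℤ) - 1) = 0) := by omega
      simp only [heis_neg_single, h1, if_false, zero_smul, add_zero]
      congr 1
      ring
    · have h1 : ¬(i = j ∧ -(r : ℤ) - 1 + 0 = 0) := by omega
      rw [if_neg h1]
      simp only [heis_neg_single, heis_zero_single, zero_smul, add_zero, mul_smul_comm]
    · simp only [heis_neg_single, heis_pos_single, Derivation.leibniz, MvPolynomial.pderiv_X]
      by_cases h1 : i = j ∧ r = s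
      · obtain ⟨rfl, rfl⟩ := h1
        have h2 : i = i ∧ -(r : ℤ) - 1 + ((r : ℤ) + 1) = 0 := ⟨rfl, by omega⟩
        rw [if_pos h2]
        simp only [Pi.single_eq_same, Finsupp.smul_single, ← Finsupp.single_add]
        congr 1
        simp only [smul_eq_mul, MvPolynomial.smul_eq_C_mul]
        push_cast
        simp only [map_add, map_sub, map_neg, map_one]
        ring
      · have h2 : ¬(i = j ∧ -(r : ℤ) - 1 + ((s : ℤ) + 1) = 0) := by omega
        have h3 : (i, r) ≠ (j, s) := fun h => h1 (by simpa using h)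
        simp only [h2, if_false, zero_smul, add_zero, Pi.single_eq_of_ne h3, smul_eq_mul, mul_zero,
          mul_smul_comm]
    · have h1 : ¬(i = j ∧ 0 + (-(s : ℤ) - 1) = 0) := by omega
      rw [if_neg h1]
      simp only [heis_neg_single, heis_zero_single, zero_smul, add_zero, mul_smul_comm]
    · simp only [heis_zero_single, Int.cast_zero, ite_self, zero_smul, add_zero, smul_smul]
      rw [mul_comm]
    · have h1 : ¬(i = j ∧ 0 + ((s : ℤ) + 1) = 0) := by omega
      rw [if_neg h1]
      simp only [heis_pos_single, heis_zero_single, zero_smul, add_zero, Derivation.map_smul]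
      rw [smul_comm]
    · simp only [heis_neg_single, heis_pos_single, Derivation.leibniz, MvPolynomial.pderiv_X]
      by_cases h1 : i = j ∧ r = s
      · obtain ⟨rfl, rfl⟩ := h1
        have h2 : i = i ∧ (r : ℤ) + 1 + (-(r : ℤ) - 1) = 0 := ⟨rfl, by omega⟩
        rw [if_pos h2]
        simp only [Pi.single_eq_same, Finsupp.smul_single, ← Finsupp.single_add]
        congr 1
        simp only [smul_eq_mul, MvPolynomial.smul_eq_C_mul]
        push_cast
        simp only [map_add, map_one]
        ring
      · have h2 : ¬(i = j ∧ (r : ℤ) + 1 + (-(s : ℤ) - 1) = 0) := by omega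
        have h3 : (j, s) ≠ (i, r) := fun h => h1 (by simpa [eq_comm] using h)
        simp only [h2, if_false, zero_smul, add_zero, Pi.single_eq_of_ne h3, smul_eq_mul, mul_zero,
          mul_smul_comm]
    · have h1 : ¬(i = j ∧ (r : ℤ) + 1 + 0 = 0) := by omega
      rw [if_neg h1]
      simp only [heis_pos_single, heis_zero_single, zero_smul, add_zero, Derivation.map_smul]
      rw [smul_comm]
    · have h1 : ¬(i = j ∧ (r : ℤ) + 1 + ((s : ℤ) + 1) = 0) := by omega
      rw [if_neg h1]
      simp only [heis_pos_single, zero_smul, add_zero, Derivation.map_smul]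
      rw [smul_comm, pderiv_comm]

theorem ncoeff_heisField (s : Fin d × ℕ) (m : ℤ) :
    (heisField B h s).ncoeff m =
      ((Ring.choose ((s.2 : ℤ) - m - 1) s.2 : ℤ) : ℂ) • heis B h s.1 (m - s.2) :=
  ncoeff_ofModes _ _ _

theorem ncoeff_heisField_zero (i : Fin d) (m : ℤ) :
    (heisField B h (i, 0)).ncoeff m = heis B h i m := by
  simp [ncoeff_heisField]

/-- Normally ordered multiplications by derivatives of Heisenberg fields commute: a mode of index
`a ≥ 0` of `∂^(r) h_i(z)` is a multiple of `h_i(a - r)`, with coefficient zero if `a < r`. -/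
theorem normalOrder_heisField_comm (s t : Fin d × ℕ) (C : VertexOperator ℂ (Space L d)) :
    normalOrder (heisField B h s) (normalOrder (heisField B h t) C) =
      normalOrder (heisField B h t) (normalOrder (heisField B h s) C) := by
  have hchoose : ∀ r a : ℕ, a < r → ((Ring.choose ((r : ℤ) - a - 1) r : ℤ) : ℂ) = 0 := by
    intro r a har
    rw [show (r : ℤ) - a - 1 = ((r - a - 1 : ℕ) : ℤ) by omega, Ring.choose_natCast,
      Nat.choose_eq_zero_of_lt (by omega)]
    simp
  refine normalOrder_left_comm _ _ _ (fun a b x => ?_) (fun a b x => ?_)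
  · simp only [ncoeff_heisField, LinearMap.smul_apply, map_smul]
    rw [heis_commutator, if_neg (by omega), zero_smul, add_zero, smul_comm]
  · simp only [ncoeff_heisField, LinearMap.smul_apply, map_smul]
    by_cases ha : a < s.2
    · simp only [hchoose _ _ ha, zero_smul, smul_zero]
    by_cases hb : b < t.2
    · simp only [hchoose _ _ hb, zero_smul, smul_zero]
    have h0 : (if s.1 = t.1 ∧ ((a : ℤ) - s.2) + (b - t.2) = 0 then (((a : ℤ) - s.2 : ℤ) : ℂ)
        else 0) = 0 := by
      split_ifs with h1
      · rw [show (a : ℤ) - s.2 = 0 by omega, Int.cast_zero]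
      · rfl
    rw [heis_commutator, h0, zero_smul, add_zero, smul_comm]

theorem pairing_zero_right (i : Fin d) : pairing B h i 0 = 0 := by
  simp [pairing]

theorem pairing_add_right (i : Fin d) (α β : L) :
    pairing B h i (α + β) = pairing B h i α + pairing B h i β := by
  simp [pairing, TensorProduct.tmul_add]

theorem expCreation_zero : expCreation B h (0 : L) = 1 := by
  have hz : ∀ g : PowerSeries (Fock d), g = 0 → (PowerSeries.exp (Fock d)).subst g = 1 := by
    rintro _ rfl
    refine (PowerSeries.subst_zero_eq_C_constantCoeff (R := Fock d) (S := Fock d)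
      (τ := Unit) (f := PowerSeries.exp (Fock d))).trans ?_
    simp
  refine hz _ ?_
  ext n : 1
  rcases n with _ | r <;> simp [pairing_zero_right]

theorem expAnnihilation_zero (f : Fock d) : expAnnihilation B h (0 : L) f = HahnSeries.C f := by
  have : expAnnihilation B h (0 : L) = HahnSeries.C := by
    apply MvPolynomial.ringHom_ext
    · intro c
      simp [expAnnihilation]
    · intro s
      simp [expAnnihilation, pairing_zero_right, HahnSeries.C_apply]
  rw [this]

variable (ε : L → L → ℤˣ)

/-- `Y(e^0, z)` is the identity. -/
theorem ncoeff_expField_zero (hε : ∀ β, ε 0 β = 1) (n : ℤ) (x : Space L d) :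
    (expField B ε h 0).ncoeff n x = if n = -1 then x else 0 := by
  rw [expField, ncoeff_ofModes]
  induction x using Finsupp.induction_linear with
  | zero => simp
  | add x y hx hy => rw [map_add, hx, hy]; split_ifs <;> simp
  | single β f =>
    have hs : expSeries B ε h 0 β f = HahnSeries.single (0 : ℤ) f := by
      simp [expSeries, expCreation_zero, expAnnihilation_zero, hε, HahnSeries.C_apply]
    rw [expMode, Finsupp.lsum_single, LinearMap.comp_apply, Finsupp.lsingle_apply, zero_add]
    change Finsupp.single β ((expSeries B ε h 0 β f).coeff (-n - 1)) = _
    rw [hs]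
    by_cases hn : n = -1
    · simp [hn]
    · rw [HahnSeries.coeff_single_of_ne (by omega), if_neg hn, Finsupp.single_zero]

end Heisenberg

/-! ### The fields of polynomials in the `h_i(-1)` -/

section PolyField

variable {L : Type*} [AddCommGroup L] {d : ℕ}
variable (B : LinearMap.BilinForm ℤ L) (ε : L → L → ℤˣ) (h : Fin d → ℂ ⊗[ℤ] L)

/-- The linear map `R ↦ Y(v_R, z)`. -/
noncomputable def polyField :
    MvPolynomial (Fin d) ℂ →ₗ[ℂ] VertexOperator ℂ (Space L d) :=
  Y B ε h ∘ₗ Finsupp.lsingle 0 ∘ₗ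
    (MvPolynomial.aeval (fun i => (MvPolynomial.X (i, 0) : Fock d))).toLinearMap

theorem polyField_apply (R : MvPolynomial (Fin d) ℂ) : polyField B ε h R = Y B ε h (vec L R) :=
  rfl

theorem aeval_X_zero (R : MvPolynomial (Fin d) ℂ) :
    MvPolynomial.aeval (fun i => (MvPolynomial.X (i, 0) : Fock d)) R =
      MvPolynomial.rename (fun i => (i, 0)) R := by
  have h1 : MvPolynomial.aeval (fun i => (MvPolynomial.X (i, 0) : Fock d)) =
      MvPolynomial.rename (R := ℂ) (fun i => (i, 0)) :=
    MvPolynomial.algHom_ext fun i => by rw [MvPolynomial.aeval_X, MvPolynomial.rename_X]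
  rw [h1]

theorem polyField_monomial (ν : Fin d →₀ ℕ) :
    polyField B ε h (MvPolynomial.monomial ν 1) =
      monomialField B ε h 0 (ν.mapDomain fun i => (i, 0)) := by
  rw [polyField_apply, vec, aeval_X_zero, MvPolynomial.rename_monomial, Y, Finsupp.lsum_single]
  exact (MvPolynomial.basisMonomials (Fin d × ℕ) ℂ).constr_basis ℂ _ _

/-- Fields of monomials can be built up in any order, by `normalOrder_heisField_comm`. -/
theorem monomialField_single_add (α : L) (s : Fin d × ℕ) (μ : Fin d × ℕ →₀ ℕ) :
    monomialField B ε h α (Finsupp.single s 1 + μ) =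
      normalOrder (heisField B h s) (monomialField B ε h α μ) := by
  have hperm : (Finsupp.toMultiset (Finsupp.single s 1 + μ)).toList.Perm
      (s :: (Finsupp.toMultiset μ).toList) := by
    rw [← Multiset.coe_eq_coe, Multiset.coe_toList, ← Multiset.cons_coe, Multiset.coe_toList,
      map_add, Finsupp.toMultiset_single, one_smul, Multiset.singleton_add]
  rw [monomialField, List.Perm.foldr_eq' (f := fun s A => normalOrder (heisField B h s) A) hperm
    (fun _ _ _ _ _ => normalOrder_heisField_comm B h _ _ _), List.foldr_cons, monomialField]

theorem polyField_X_mul (i : Fin d) (R : MvPolynomial (Fin d) ℂ) :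
    polyField B ε h (MvPolynomial.X i * R) =
      normalOrder (heisField B h (i, 0)) (polyField B ε h R) := by
  induction R using MvPolynomial.induction_on' with
  | monomial ν c =>
    have h1 : MvPolynomial.monomial ν c = c • (MvPolynomial.monomial ν 1 : MvPolynomial _ ℂ) := by
      simp [MvPolynomial.smul_monomial]
    rw [h1, mul_smul_comm, map_smul, map_smul, normalOrder_smul_right, MvPolynomial.X,
      MvPolynomial.monomial_mul, one_mul, polyField_monomial, polyField_monomial,
      Finsupp.mapDomain_add, Finsupp.mapDomain_single, monomialField_single_add]
  | add p q hp hq => rw [mul_add, map_add, map_add, hp, hq, normalOrder_add_right]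

variable {ε} in
theorem ncoeff_polyField_C (hε : ∀ β, ε 0 β = 1) (c : ℂ) (n : ℤ) (x : Space L d) :
    (polyField B ε h (MvPolynomial.C c)).ncoeff n x = if n = -1 then c • x else 0 := by
  have h1 : (MvPolynomial.C c : MvPolynomial (Fin d) ℂ) = c • MvPolynomial.monomial 0 1 := by
    rw [MvPolynomial.smul_monomial, smul_eq_mul, mul_one, MvPolynomial.C_apply]
  rw [h1, map_smul, ncoeff_smul_apply, polyField_monomial, Finsupp.mapDomain_zero, monomialField,
    map_zero, Multiset.toList_zero, List.foldr_nil, ncoeff_expField_zero B h ε hε]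
  split_ifs <;> simp

/-- The modes of `Y(v_{X_i R}, z)`, with the two series cut off. -/
theorem eventually_polyField_X_mul (i : Fin d) (R : MvPolynomial (Fin d) ℂ) (n : ℤ)
    (x : Space L d) :
    ∀ᶠ M : ℕ in Filter.atTop, (polyField B ε h (MvPolynomial.X i * R)).ncoeff n x =
      ∑ j ∈ Finset.range M,
        (heis B h i (-(j : ℤ) - 1) ((polyField B ε h R).ncoeff (n + j) x) +
          (polyField B ε h R).ncoeff (n - j - 1) (heis B h i (j : ℤ) x)) := by
  rw [polyField_X_mul]
  simpa only [ncoeff_heisField_zero] using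
    eventually_normalOrder_apply (heisField B h (i, 0)) (polyField B ε h R) n x

variable {ε} in
theorem ncoeff_polyField_X (hε : ∀ β, ε 0 β = 1) (i : Fin d) (n : ℤ) (x : Space L d) :
    (polyField B ε h (MvPolynomial.X i)).ncoeff n x = heis B h i n x := by
  obtain ⟨M, h1, h2⟩ := ((eventually_polyField_X_mul B ε h i (MvPolynomial.C 1) n x).and
    (Filter.eventually_gt_atTop n.natAbs)).exists
  rw [map_one, mul_one, ← map_one MvPolynomial.C] at h1
  rw [h1]
  simp only [ncoeff_polyField_C B h hε, one_smul]
  rcases lt_or_ge n 0 with hn | hn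
  · rw [Finset.sum_eq_single (-n - 1).toNat]
    · rw [if_pos (by omega), if_neg (by omega), add_zero]
      congr 2
      omega
    · intro j _ hj
      rw [if_neg (by omega), if_neg (by omega), map_zero, add_zero]
    · intro hj
      rw [Finset.mem_range] at hj
      omega
  · rw [Finset.sum_eq_single n.toNat]
    · rw [if_neg (by omega), if_pos (by omega), map_zero, zero_add]
      congr 2
      omega
    · intro j _ hj
      rw [if_neg (by omega), if_neg (by omega), map_zero, add_zero]
    · intro hj
      rw [Finset.mem_range] at hj
      omega

variable {ε} in
/-- `[h_i(m), v_R(n)] = m v_{∂_i R}(n + m - 1)`. -/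
theorem heis_polyField_commutator (hε : ∀ β, ε 0 β = 1) (i : Fin d) (m : ℤ)
    (R : MvPolynomial (Fin d) ℂ) (n : ℤ) (x : Space L d) :
    heis B h i m ((polyField B ε h R).ncoeff n x) =
      (polyField B ε h R).ncoeff n (heis B h i m x) +
        (m : ℂ) • (polyField B ε h (MvPolynomial.pderiv i R)).ncoeff (n + m - 1) x := by
  classical
  induction R using MvPolynomial.induction_on generalizing n x with
  | C c =>
    simp only [ncoeff_polyField_C B h hε, MvPolynomial.pderiv_C, map_zero, Pi.zero_apply,
      LinearMap.zero_apply, smul_zero, add_zero]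
    split_ifs <;> simp
  | add p q hp hq =>
    simp only [map_add, Pi.add_apply, LinearMap.add_apply] at hp hq ⊢
    rw [hp, hq, smul_add]
    abel
  | mul_X S j ih =>
    rw [mul_comm S]
    obtain ⟨M, h1, h2, h3, hM⟩ := ((eventually_polyField_X_mul B ε h j S n x).and
      ((eventually_polyField_X_mul B ε h j S n (heis B h i m x)).and
      ((eventually_polyField_X_mul B ε h j (MvPolynomial.pderiv i S) (n + m - 1) x).and
      (Filter.eventually_gt_atTop m.natAbs)))).exists
    have hd : MvPolynomial.pderiv i (MvPolynomial.X j * S) =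
        (if i = j then (1 : ℂ) else 0) • S + MvPolynomial.X j * MvPolynomial.pderiv i S := by
      rw [Derivation.leibniz, MvPolynomial.pderiv_X, smul_eq_mul, smul_eq_mul, add_comm]
      congr 1
      split_ifs with hij
      · subst hij
        simp
      · rw [Pi.single_eq_of_ne (Ne.symm hij), mul_zero, zero_smul]
    -- the contribution of the commutators `[h_i(m), h_j(n)]`
    have hδ : ∑ a ∈ Finset.range M,
        ((if i = j ∧ m + (-(a : ℤ) - 1) = 0 then (m : ℂ) else 0) •
            (polyField B ε h S).ncoeff (n + a) x +
          (if i = j ∧ m + (a : ℤ) = 0 then (m : ℂ) else 0) •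
            (polyField B ε h S).ncoeff (n - a - 1) x) =
        (m : ℂ) • (if i = j then (1 : ℂ) else 0) • (polyField B ε h S).ncoeff (n + m - 1) x := by
      by_cases hij : i = j
      swap
      · simp [hij]
      rw [if_pos hij, one_smul]
      rcases lt_or_ge 0 m with hm | hm
      · rw [Finset.sum_eq_single (m - 1).toNat]
        · rw [if_pos ⟨hij, by omega⟩, if_neg (by omega), zero_smul, add_zero,
            show n + ((m - 1).toNat : ℤ) = n + m - 1 by omega]
        · intro a _ ha
          rw [if_neg (by omega), if_neg (by omega), zero_smul, zero_smul, add_zero]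
        · intro ha
          rw [Finset.mem_range] at ha
          omega
      · rw [Finset.sum_eq_single (-m).toNat]
        · rw [if_pos (c := i = j ∧ m + ((-m).toNat : ℤ) = 0) ⟨hij, by omega⟩, if_neg (by omega),
            zero_smul, zero_add, show n - ((-m).toNat : ℤ) - 1 = n + m - 1 by omega]
        · intro a _ ha
          rw [if_neg (by omega), if_neg (by omega), zero_smul, zero_smul, add_zero]
        · intro ha
          rw [Finset.mem_range] at ha
          omega
    rw [hd, map_add, map_smul, ncoeff_add_apply, ncoeff_smul_apply, smul_add, ← hδ, h1, h2, h3,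
      map_sum, Finset.smul_sum, ← Finset.sum_add_distrib, ← Finset.sum_add_distrib]
    refine Finset.sum_congr rfl fun a _ => ?_
    rw [map_add, heis_commutator, ih, ih, heis_commutator B h i j m a]
    simp only [map_add, map_smul, smul_add]
    rw [show n + (a : ℤ) + m - 1 = n + m - 1 + a by ring,
      show n - (a : ℤ) - 1 + m - 1 = n + m - 1 - a - 1 by ring]
    abel

end PolyField

/-! ### The bigrading of `V_L` -/

section Blocks

variable {L : Type*} {d : ℕ}

/-- The weight of a monomial in the variables `h_i(-(r + 1))`, each of which has weight
`r + 1`. -/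
noncomputable def wt (μ : Fin d × ℕ →₀ ℕ) : ℕ := Finsupp.weight (fun s : Fin d × ℕ => s.2 + 1) μ

theorem wt_zero : wt (0 : Fin d × ℕ →₀ ℕ) = 0 := map_zero _

theorem wt_add (μ ν : Fin d × ℕ →₀ ℕ) : wt (μ + ν) = wt μ + wt ν := map_add _ _ _

theorem wt_single_one (s : Fin d × ℕ) : wt (Finsupp.single s 1) = s.2 + 1 := by
  simp [wt, Finsupp.weight_single]

variable (d) in
/-- The homogeneous part of weight `N` of the Fock space; it is zero for `N < 0`. -/
def fockGrade (N : ℤ) : Submodule ℂ (Fock d) where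
  carrier := {f | ∀ μ, MvPolynomial.coeff μ f ≠ 0 → (wt μ : ℤ) = N}
  zero_mem' := fun μ hμ => absurd (MvPolynomial.coeff_zero μ) hμ
  add_mem' := fun {f g} hf hg μ hμ => by
    by_contra hne
    rw [MvPolynomial.coeff_add, not_imp_comm.1 (hf μ) hne, not_imp_comm.1 (hg μ) hne,
      add_zero] at hμ
    exact hμ rfl
  smul_mem' := fun c f hf μ hμ => hf μ fun h0 => hμ (by rw [MvPolynomial.coeff_smul, h0, smul_zero])

theorem monomial_mem_fockGrade (μ : Fin d × ℕ →₀ ℕ) (c : ℂ) :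
    (MvPolynomial.monomial μ c : Fock d) ∈ fockGrade d (wt μ) := by
  classical
  intro ν hν
  rw [MvPolynomial.coeff_monomial] at hν
  rw [(ite_ne_right_iff.1 hν).1]

theorem X_mul_mem_fockGrade {N : ℤ} {f : Fock d} (hf : f ∈ fockGrade d N) (s : Fin d × ℕ) :
    MvPolynomial.X s * f ∈ fockGrade d (N + s.2 + 1) := by
  classical
  intro μ hμ
  rw [MvPolynomial.coeff_X_mul'] at hμ
  obtain ⟨hs, hμ⟩ := ite_ne_right_iff.1 hμ
  have h1 : μ = (μ - Finsupp.single s 1) + Finsupp.single s 1 := by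
    rw [tsub_add_cancel_of_le]
    rw [Finsupp.single_le_iff]
    exact Nat.one_le_iff_ne_zero.2 (Finsupp.mem_support_iff.1 hs)
  rw [h1, wt_add, wt_single_one]
  have := hf _ hμ
  push_cast
  omega

theorem pderiv_mem_fockGrade {N : ℤ} {f : Fock d} (hf : f ∈ fockGrade d N) (s : Fin d × ℕ) :
    MvPolynomial.pderiv s f ∈ fockGrade d (N - s.2 - 1) := by
  intro μ hμ
  rw [MvPolynomial.coeff_pderiv] at hμ
  have := hf _ (left_ne_zero_of_mul hμ)
  rw [wt_add, wt_single_one] at this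
  push_cast at this
  omega

variable (d) in
/-- The subspace `M(1)_N ⊗ e^α` of `V_L`. -/
noncomputable def block (α : L) (N : ℤ) : Submodule ℂ (Space L d) :=
  (fockGrade d N).map (Finsupp.lsingle α)

theorem single_mem_block (α : L) {N : ℤ} {f : Fock d} (hf : f ∈ fockGrade d N) :
    (Finsupp.single α f : Space L d) ∈ block d α N := ⟨f, hf, rfl⟩

variable [AddCommGroup L]

theorem heis_mem_block (B : LinearMap.BilinForm ℤ L) (h : Fin d → ℂ ⊗[ℤ] L) (i : Fin d) (m : ℤ)
    {α : L} {N : ℤ} {x : Space L d} (hx : x ∈ block d α N) :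
    heis B h i m x ∈ block d α (N - m) := by
  obtain ⟨f, hf, rfl⟩ := hx
  rw [Finsupp.lsingle_apply]
  rcases int_cases m with ⟨r, rfl⟩ | rfl | ⟨r, rfl⟩
  · rw [heis_neg_single]
    have := X_mul_mem_fockGrade hf (i, r)
    rw [show N + (r : ℤ) + 1 = N - (-(r : ℤ) - 1) by ring] at this
    exact single_mem_block α this
  · rw [heis_zero_single, sub_zero]
    exact single_mem_block α (Submodule.smul_mem _ _ hf)
  · rw [heis_pos_single]
    have := pderiv_mem_fockGrade hf (i, r)
    rw [show N - (r : ℤ) - 1 = N - ((r : ℤ) + 1) by ring] at this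
    exact single_mem_block α (Submodule.smul_mem _ _ this)

theorem polyField_mem_block (B : LinearMap.BilinForm ℤ L) {ε : L → L → ℤˣ}
    (h : Fin d → ℂ ⊗[ℤ] L) (hε : ∀ β, ε 0 β = 1) {k : ℕ} {R : MvPolynomial (Fin d) ℂ}
    (hR : R.IsHomogeneous k) (n : ℤ) {α : L} {N : ℤ} {x : Space L d} (hx : x ∈ block d α N) :
    (polyField B ε h R).ncoeff n x ∈ block d α (N + k - n - 1) := by
  induction k generalizing R n N x with
  | zero =>
    rw [← MvPolynomial.totalDegree_zero_iff_isHomogeneous,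
      MvPolynomial.totalDegree_eq_zero_iff_eq_C] at hR
    rw [hR, ncoeff_polyField_C B h hε]
    split_ifs with hn
    · rw [hn, show N + ((0 : ℕ) : ℤ) - -1 - 1 = N by simp]
      exact Submodule.smul_mem _ _ hx
    · exact zero_mem _
  | succ k ih =>
    -- Euler's identity reduces to polynomials `X i * S`
    have hE : R = ((k : ℂ) + 1)⁻¹ • ∑ i, MvPolynomial.X i * MvPolynomial.pderiv i R := by
      rw [hR.sum_X_mul_pderiv, ← Nat.cast_smul_eq_nsmul ℂ, smul_smul, Nat.cast_succ,
        inv_mul_cancel₀ (Nat.cast_add_one_ne_zero k), one_smul]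
    rw [hE, map_smul, ncoeff_smul_apply, map_sum, map_sum, Finset.sum_apply, LinearMap.sum_apply]
    refine Submodule.smul_mem _ _ (Submodule.sum_mem _ fun i _ => ?_)
    obtain ⟨M, hM⟩ := (eventually_polyField_X_mul B ε h i (MvPolynomial.pderiv i R) n x).exists
    rw [hM]
    have hdR : (MvPolynomial.pderiv i R).IsHomogeneous k := hR.pderiv
    refine Submodule.sum_mem _ fun j _ => Submodule.add_mem _ ?_ ?_
    · convert heis_mem_block B h i (-(j : ℤ) - 1) (ih hdR (n + j) hx) using 1
      congr 1
      push_cast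
      ring
    · convert ih hdR (n - j - 1) (heis_mem_block B h i j hx) using 1
      congr 1
      push_cast
      ring

end Blocks

/-! ### Generating functions over finitely supported families -/

section EulerProduct

variable {ι : Type*} {𝕜 : Type*} [NormedField 𝕜]

/-- A finitely supported family `μ` with support in `insert a s` amounts to its value at `a`
together with a family supported in `s`. -/
noncomputable def supportInsertEquiv [DecidableEq ι] {a : ι} {s : Finset ι} (ha : a ∉ s) :
    ℕ × {μ : ι →₀ ℕ // μ.support ⊆ s} ≃ {μ : ι →₀ ℕ // μ.support ⊆ insert a s} where
  toFun p := ⟨Finsupp.single a p.1 + p.2.1, fun i hi => by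
    rcases Finset.mem_union.1 (Finsupp.support_add hi) with h1 | h1
    · exact Finset.mem_insert.2 (Or.inl (Finset.mem_singleton.1 (Finsupp.support_single_subset h1)))
    · exact Finset.mem_insert_of_mem (p.2.2 h1)⟩
  invFun μ := (μ.1 a, ⟨μ.1.erase a, fun i hi => by
    rw [Finsupp.support_erase, Finset.mem_erase] at hi
    exact (Finset.mem_insert.1 (μ.2 hi.2)).resolve_left hi.1⟩)
  left_inv p := by
    have h0 : p.2.1 a = 0 := Finsupp.notMem_support_iff.1 fun h1 => ha (p.2.2 h1)
    refine Prod.ext (by simp [h0]) (Subtype.ext ?_)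
    simp only [Finsupp.erase_add, Finsupp.erase_single, zero_add]
    exact Finsupp.erase_of_notMem_support (fun h1 => ha (p.2.2 h1))
  right_inv μ := Subtype.ext (Finsupp.single_add_erase a μ.1)

theorem finsupp_prod_single_add {x : ι → 𝕜} (a : ι) (m : ℕ) (μ : ι →₀ ℕ) :
    (Finsupp.single a m + μ).prod (fun i n => x i ^ n) =
      x a ^ m * μ.prod fun i n => x i ^ n := by
  classical
  rw [Finsupp.prod_add_index' (fun _ => pow_zero _) (fun _ _ _ => pow_add _ _ _),
    Finsupp.prod_single_index (h := fun i n => x i ^ n) (pow_zero _)]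

variable [CompleteSpace 𝕜]

theorem hasSum_prod_pow_of_finset {x : ι → 𝕜} (hx : ∀ i, ‖x i‖ < 1) (s : Finset ι) :
    (Summable fun μ : {μ : ι →₀ ℕ // μ.support ⊆ s} => ‖μ.1.prod fun i n => x i ^ n‖) ∧
    HasSum (fun μ : {μ : ι →₀ ℕ // μ.support ⊆ s} => μ.1.prod fun i n => x i ^ n)
      (∏ i ∈ s, (1 - x i)⁻¹) := by
  classical
  induction s using Finset.induction_on with
  | empty =>
    have : Unique {μ : ι →₀ ℕ // μ.support ⊆ ∅} :=
      { default := ⟨0, by simp⟩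
        uniq := fun μ => Subtype.ext (by simpa using μ.2) }
    refine ⟨(hasSum_fintype _).summable, ?_⟩
    convert hasSum_fintype (fun μ : {μ : ι →₀ ℕ // μ.support ⊆ ∅} => μ.1.prod fun i n => x i ^ n)
    rw [Fintype.sum_unique, Finset.prod_empty]
    have h0 : ∀ μ : {μ : ι →₀ ℕ // μ.support ⊆ ∅}, μ.1 = 0 := fun μ =>
      Finsupp.support_eq_empty.1 (Finset.subset_empty.1 μ.2)
    rw [h0]
    exact (Finsupp.prod_zero_index (h := fun i n => x i ^ n)).symm
  | insert a s ha ih =>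
    have hg : Summable fun m : ℕ => ‖x a ^ m‖ := by
      simpa only [norm_pow] using summable_geometric_of_lt_one (norm_nonneg _) (hx a)
    have hcomp : (fun μ : {μ : ι →₀ ℕ // μ.support ⊆ insert a s} =>
        μ.1.prod fun i n => x i ^ n) ∘ supportInsertEquiv ha =
        fun p : ℕ × {μ : ι →₀ ℕ // μ.support ⊆ s} =>
          x a ^ p.1 * p.2.1.prod fun i n => x i ^ n :=
      funext fun p => finsupp_prod_single_add a p.1 p.2.1
    constructor
    · rw [← (supportInsertEquiv ha).summable_iff]
      have h1 := hg.mul_of_nonneg ih.1 (fun _ => norm_nonneg _) (fun _ => norm_nonneg _)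
      refine h1.congr fun p => ?_
      rw [← norm_mul]
      exact congrArg norm (congrFun hcomp p).symm
    · rw [← (supportInsertEquiv ha).hasSum_iff, hcomp, Finset.prod_insert ha]
      have hm := summable_mul_of_summable_norm (f := fun m : ℕ => x a ^ m)
        (g := fun μ : {μ : ι →₀ ℕ // μ.support ⊆ s} => μ.1.prod fun i n => x i ^ n) hg ih.1
      have hgeom : HasSum (fun m : ℕ => x a ^ m) (1 - x a)⁻¹ :=
        hasSum_geometric_of_norm_lt_one (hx a)
      have h3 := HasSum.mul hgeom ih.2 hm
      exact h3

/-- `∑_μ ∏_i x_i ^ μ_i = ∏_i (1 - x_i)⁻¹`, the infinite product being taken along an exhausting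
sequence `s` of finite sets. -/
theorem hasSum_prod_pow {x : ι → 𝕜} (hx : ∀ i, ‖x i‖ < 1) {s : ℕ → Finset ι}
    (hs : ∀ t : Finset ι, ∀ᶠ K in Filter.atTop, t ⊆ s K) {P : 𝕜} {C : ℝ}
    (hC : ∀ K, ∏ i ∈ s K, (1 - ‖x i‖)⁻¹ ≤ C)
    (hP : Filter.Tendsto (fun K => ∏ i ∈ s K, (1 - x i)⁻¹) Filter.atTop (nhds P)) :
    (Summable fun μ : ι →₀ ℕ => ‖μ.prod fun i n => x i ^ n‖) ∧
    HasSum (fun μ : ι →₀ ℕ => μ.prod fun i n => x i ^ n) P := by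
  classical
  have hnorm : ∀ μ : ι →₀ ℕ, ‖μ.prod fun i n => x i ^ n‖ = μ.prod fun i n => ‖x i‖ ^ n :=
    fun μ => by simp only [Finsupp.prod, norm_prod, norm_pow]
  have hpos : ∀ μ : ι →₀ ℕ, 0 ≤ μ.prod fun i n => ‖x i‖ ^ n := fun μ => by
    rw [← hnorm]
    exact norm_nonneg _
  have hsum : Summable fun μ : ι →₀ ℕ => ‖μ.prod fun i n => x i ^ n‖ := by
    refine summable_of_sum_le (fun _ => norm_nonneg _) (c := C) fun u => ?_
    obtain ⟨K, hK⟩ := (hs (u.biUnion fun μ => μ.support)).exists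
    have h1 := hasSum_prod_pow_of_finset (x := fun i => ‖x i‖)
      (fun i => by rw [norm_norm]; exact hx i) (s K)
    have hu : ∀ μ ∈ u, μ.support ⊆ s K := fun μ hμ =>
      (Finset.subset_biUnion_of_mem (fun μ : ι →₀ ℕ => μ.support) hμ).trans hK
    calc ∑ μ ∈ u, ‖μ.prod fun i n => x i ^ n‖
        = ∑ μ ∈ u.subtype (fun μ : ι →₀ ℕ => μ.support ⊆ s K), μ.1.prod fun i n => ‖x i‖ ^ n := by
          rw [Finset.sum_subtype_of_mem (fun μ : ι →₀ ℕ => μ.prod fun i n => ‖x i‖ ^ n) hu]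
          exact Finset.sum_congr rfl fun μ _ => hnorm μ
      _ ≤ ∏ i ∈ s K, (1 - ‖x i‖)⁻¹ :=
          sum_le_hasSum _ (fun μ _ => hpos μ.1) h1.2
      _ ≤ C := hC K
  refine ⟨hsum, ?_⟩
  have hlim : Filter.Tendsto (fun K => ∑' μ : ι →₀ ℕ,
      Set.indicator {μ : ι →₀ ℕ | μ.support ⊆ s K} (fun μ => μ.prod fun i n => x i ^ n) μ)
      Filter.atTop (nhds (∑' μ : ι →₀ ℕ, μ.prod fun i n => x i ^ n)) := by
    refine tendsto_tsum_of_dominated_convergence hsum (fun μ => ?_) (Filter.Eventually.of_forall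
      fun K μ => norm_indicator_le_norm_self _ _)
    refine tendsto_const_nhds.congr' ?_
    filter_upwards [hs μ.support] with K hK
    exact (Set.indicator_of_mem (s := {μ : ι →₀ ℕ | μ.support ⊆ s K}) hK
      (fun μ => μ.prod fun i n => x i ^ n)).symm
  have heq : P = ∑' μ : ι →₀ ℕ, μ.prod fun i n => x i ^ n := by
    refine tendsto_nhds_unique (hP.congr fun K => ?_) hlim
    rw [← tsum_subtype]
    exact (hasSum_prod_pow_of_finset hx (s K)).2.tsum_eq.symm
  rw [heq]
  exact hsum.of_norm.hasSum

end EulerProduct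

section Character

variable {d : ℕ}

theorem prod_pow_eq_pow_wt {𝕜 : Type*} [CommSemiring 𝕜] (q : 𝕜) (μ : Fin d × ℕ →₀ ℕ) :
    (μ.prod fun s n => (q ^ (s.2 + 1)) ^ n) = q ^ wt μ := by
  rw [wt, Finsupp.weight_apply, Finsupp.sum, Finsupp.prod, ← Finset.prod_pow_eq_pow_sum]
  refine Finset.prod_congr rfl fun s _ => ?_
  rw [← pow_mul, smul_eq_mul, mul_comm]

theorem eventually_subset_univ_product_range (t : Finset (Fin d × ℕ)) :
    ∀ᶠ K in Filter.atTop, t ⊆ Finset.univ ×ˢ Finset.range K := by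
  classical
  obtain ⟨T, hT⟩ := (t.image Prod.snd).exists_le
  filter_upwards [Filter.eventually_gt_atTop T] with K hK s hs
  have := hT _ (Finset.mem_image_of_mem _ hs)
  simp only [Finset.mem_product, Finset.mem_univ, Finset.mem_range, true_and]
  omega

theorem prod_univ_product_range {𝕜 : Type*} [Field 𝕜] (q : 𝕜) (K : ℕ) :
    ∏ s ∈ (Finset.univ : Finset (Fin d)) ×ˢ Finset.range K, (1 - q ^ (s.2 + 1))⁻¹ =
      ((∏ r ∈ Finset.range K, (1 - q ^ (r + 1)))⁻¹) ^ d := by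
  rw [Finset.prod_product]
  simp [Finset.prod_inv_distrib]

/-- The character of the Fock space: `∑_μ q ^ wt μ = ∏_{n ≥ 1} (1 - q ^ n) ^ (-d)`. -/
theorem hasSum_pow_wt {q : ℂ} (hq : ‖q‖ < 1) :
    (Summable fun μ : Fin d × ℕ →₀ ℕ => ‖q ^ wt μ‖) ∧
    HasSum (fun μ : Fin d × ℕ →₀ ℕ => q ^ wt μ) (((∏' n : ℕ, (1 - q ^ (n + 1)))⁻¹) ^ d) := by
  have hlt : ∀ p : ℂ, ‖p‖ < 1 → Filter.Tendsto (fun K => ∏ s ∈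
      (Finset.univ : Finset (Fin d)) ×ˢ Finset.range K, (1 - p ^ (s.2 + 1))⁻¹) Filter.atTop
      (nhds (((∏' n : ℕ, (1 - p ^ (n + 1)))⁻¹) ^ d)) := by
    intro p hp
    simp only [prod_univ_product_range]
    have hne : ∏' n : ℕ, (1 - p ^ (n + 1)) ≠ 0 := by
      refine tprod_one_add_ne_zero_of_summable (f := fun n : ℕ => -p ^ (n + 1)) (fun n h0 => ?_) ?_
      · have h1 : ‖p ^ (n + 1)‖ < 1 := by
          rw [norm_pow]
          exact pow_lt_one₀ (norm_nonneg _) hp (Nat.succ_ne_zero n)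
        have h2 : p ^ (n + 1) = 1 := by linear_combination -h0
        rw [h2, norm_one] at h1
        exact lt_irrefl _ h1
      · simpa using (summable_nat_add_iff 1).mpr (summable_geometric_of_lt_one (norm_nonneg _) hp)
    exact ((ModularForm.multipliable_one_sub_pow hp).hasProd.tendsto_prod_nat.inv₀ hne).pow d
  have hbd : ∃ C : ℝ, ∀ K, ∏ s ∈ (Finset.univ : Finset (Fin d)) ×ˢ Finset.range K,
      (1 - ‖q ^ (s.2 + 1)‖)⁻¹ ≤ C := by
    obtain ⟨C, hC⟩ := (hlt (‖q‖ : ℂ) (by simpa using hq)).norm.bddAbove_range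
    refine ⟨C, fun K => (le_of_eq ?_).trans (hC ⟨K, rfl⟩)⟩
    change _ = ‖∏ s ∈ Finset.univ ×ˢ Finset.range K, (1 - (‖q‖ : ℂ) ^ (s.2 + 1))⁻¹‖
    rw [norm_prod]
    refine Finset.prod_congr rfl fun s _ => ?_
    have h1 : ‖q‖ ^ (s.2 + 1) < 1 := pow_lt_one₀ (norm_nonneg _) hq (Nat.succ_ne_zero _)
    rw [norm_pow, norm_inv, ← Complex.ofReal_pow, ← Complex.ofReal_one, ← Complex.ofReal_sub,
      Complex.norm_real, Real.norm_of_nonneg (by linarith)]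
  obtain ⟨C, hC⟩ := hbd
  have := hasSum_prod_pow (x := fun s : Fin d × ℕ => q ^ (s.2 + 1))
    (fun s => by rw [norm_pow]; exact pow_lt_one₀ (norm_nonneg _) hq (Nat.succ_ne_zero _))
    eventually_subset_univ_product_range hC (hlt q hq)
  simpa only [prod_pow_eq_pow_wt] using this

variable (d) in
theorem finite_wt_eq (N : ℤ) : {μ : Fin d × ℕ →₀ ℕ | (wt μ : ℤ) = N}.Finite := by
  have h1 := (hasSum_pow_wt (d := d) (q := 1 / 2) (by norm_num)).1.tendsto_cofinite_zero
  have h2 := h1.eventually (gt_mem_nhds (show (0 : ℝ) < (1 / 2) ^ N.toNat by positivity))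
  rw [Filter.eventually_cofinite] at h2
  refine h2.subset fun μ hμ => ?_
  have hμ' : wt μ = N.toNat := by
    rw [← (show (wt μ : ℤ) = N from hμ), Int.toNat_natCast]
  change ¬‖((1 : ℂ) / 2) ^ wt μ‖ < _
  simp [hμ']

end Character

/-! ### Traces over the blocks -/

section Trace

variable {d : ℕ}

variable (d) in
/-- The monomials of weight `N`. -/
noncomputable def wtFinset (N : ℤ) : Finset (Fin d × ℕ →₀ ℕ) := (finite_wt_eq d N).toFinset

@[simp]
theorem mem_wtFinset {N : ℤ} {μ : Fin d × ℕ →₀ ℕ} : μ ∈ wtFinset d N ↔ (wt μ : ℤ) = N := by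
  simp [wtFinset]

theorem wtFinset_of_neg {N : ℤ} (hN : N < 0) : wtFinset d N = ∅ :=
  Finset.eq_empty_of_forall_notMem fun μ hμ => by
    rw [mem_wtFinset] at hμ
    omega

variable {L : Type*}

theorem single_monomial_mem_block (α : L) {N : ℤ} {μ : Fin d × ℕ →₀ ℕ} (hμ : μ ∈ wtFinset d N) :
    (Finsupp.single α (MvPolynomial.monomial μ 1) : Space L d) ∈ block d α N := by
  have := monomial_mem_fockGrade μ (1 : ℂ)
  rw [mem_wtFinset.1 hμ] at this
  exact single_mem_block α this

/-- The coordinate of a vector at the basis vector `h^μ ⊗ e^α`. -/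
noncomputable def blockCoeff (α : L) (μ : Fin d × ℕ →₀ ℕ) : Space L d →ₗ[ℂ] ℂ :=
  MvPolynomial.lcoeff ℂ μ ∘ₗ Finsupp.lapply α

@[simp]
theorem blockCoeff_apply (α : L) (μ : Fin d × ℕ →₀ ℕ) (x : Space L d) :
    blockCoeff α μ x = MvPolynomial.coeff μ (x α) := rfl

theorem eq_sum_of_mem_block {α : L} {N : ℤ} {x : Space L d} (hx : x ∈ block d α N) :
    x = ∑ μ ∈ wtFinset d N,
      blockCoeff α μ x • (Finsupp.single α (MvPolynomial.monomial μ 1) : Space L d) := by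
  classical
  obtain ⟨f, hf, rfl⟩ := hx
  have h1 : f.support ⊆ wtFinset d N := fun μ hμ =>
    mem_wtFinset.2 (hf μ (MvPolynomial.mem_support_iff.1 hμ))
  have h2 : f = ∑ μ ∈ wtFinset d N,
      MvPolynomial.coeff μ f • (MvPolynomial.monomial μ 1 : Fock d) := by
    conv_lhs => rw [f.as_sum]
    rw [Finset.sum_subset h1 fun μ _ hμ => by
      rw [MvPolynomial.notMem_support_iff.1 hμ, MvPolynomial.monomial_zero]]
    refine Finset.sum_congr rfl fun μ _ => ?_
    rw [MvPolynomial.smul_monomial, smul_eq_mul, mul_one]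
  conv_lhs => rw [h2, map_sum]
  refine Finset.sum_congr rfl fun μ _ => ?_
  rw [map_smul, blockCoeff_apply, Finsupp.lsingle_apply, Finsupp.lsingle_apply,
    Finsupp.single_eq_same]

/-- The trace over `M(1)_N ⊗ e^α` of the diagonal block of an operator on `V_L`. -/
noncomputable def blockTrace (α : L) (N : ℤ) : Module.End ℂ (Space L d) →ₗ[ℂ] ℂ :=
  ∑ μ ∈ wtFinset d N, blockCoeff α μ ∘ₗ
    LinearMap.applyₗ (Finsupp.single α (MvPolynomial.monomial μ 1) : Space L d)

theorem blockTrace_apply (α : L) (N : ℤ) (T : Module.End ℂ (Space L d)) :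
    blockTrace α N T = ∑ μ ∈ wtFinset d N,
      blockCoeff α μ (T (Finsupp.single α (MvPolynomial.monomial μ 1))) := by
  simp [blockTrace]

theorem blockTrace_of_neg (α : L) {N : ℤ} (hN : N < 0) (T : Module.End ℂ (Space L d)) :
    blockTrace α N T = 0 := by
  rw [blockTrace_apply, wtFinset_of_neg hN, Finset.sum_empty]

/-- Cyclicity of the trace. -/
theorem blockTrace_comp_comm {α : L} {N N' : ℤ} {S T : Module.End ℂ (Space L d)}
    (hT : ∀ x ∈ block d α N, T x ∈ block d α N') (hS : ∀ x ∈ block d α N', S x ∈ block d α N) :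
    blockTrace α N (S * T) = blockTrace α N' (T * S) := by
  have key : ∀ (N N' : ℤ) (S T : Module.End ℂ (Space L d)),
      (∀ x ∈ block d α N, T x ∈ block d α N') → blockTrace α N (S * T) =
        ∑ μ ∈ wtFinset d N, ∑ ν ∈ wtFinset d N',
          blockCoeff α ν (T (Finsupp.single α (MvPolynomial.monomial μ 1))) *
            blockCoeff α μ (S (Finsupp.single α (MvPolynomial.monomial ν 1))) := by
    intro N N' S T hT
    rw [blockTrace_apply]
    refine Finset.sum_congr rfl fun μ hμ => ?_
    rw [Module.End.mul_apply]
    conv_lhs => rw [eq_sum_of_mem_block (hT _ (single_monomial_mem_block α hμ))]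
    simp only [map_sum, map_smul, smul_eq_mul]
  rw [key N N' S T hT, key N' N T S hS, Finset.sum_comm]
  simp only [mul_comm]

theorem eq_zero_of_shift {D : ℤ → ℂ} {n : ℤ} (hn : 0 < n) (hneg : ∀ N < 0, D N = 0)
    (hD : ∀ N, D N = D (N - n)) (N : ℤ) : D N = 0 := by
  have h1 : ∀ m : ℕ, D N = D (N - m * n) := by
    intro m
    induction m with
    | zero => simp
    | succ m ih =>
      rw [ih, hD]
      congr 1
      push_cast
      ring
  rw [h1 (N.toNat + 1)]
  refine hneg _ ?_
  have h2 : N < ((N.toNat + 1 : ℕ) : ℤ) := by omega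
  nlinarith

variable [AddCommGroup L] (B : LinearMap.BilinForm ℤ L) {ε : L → L → ℤˣ} (h : Fin d → ℂ ⊗[ℤ] L)

/-- The traces of `h_i(-n) v_{∂_i Q}(p)` and of `v_{∂_i Q}(p) h_i(n)`, summed over `i`, vanish for
harmonic `Q`: cyclicity and the commutator formula express them through the traces at weight
`N - n`, the correction term being a mode of `v_{ΔQ} = 0`. -/
theorem sum_blockTrace_heis_eq_zero (hε : ∀ β, ε 0 β = 1) {k : ℕ} {Q : MvPolynomial (Fin d) ℂ}
    (hQ : Q.IsHomogeneous (k + 1))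
    (hΔ : ∑ i, MvPolynomial.pderiv i (MvPolynomial.pderiv i Q) = 0) (α : L) {n : ℤ} (hn : 0 < n)
    (N : ℤ) :
    ∑ i, blockTrace α N (heis B h i (-n) *
        (polyField B ε h (MvPolynomial.pderiv i Q)).ncoeff (k - 1 + n)) = 0 ∧
      ∑ i, blockTrace α N ((polyField B ε h (MvPolynomial.pderiv i Q)).ncoeff (k - 1 - n) *
        heis B h i n) = 0 := by
  have hdQ : ∀ i, (MvPolynomial.pderiv i Q).IsHomogeneous k := fun i => hQ.pderiv
  -- the commutator formula, summed over `i`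
  have hcomm : ∀ (N m p : ℤ),
      ∑ i, blockTrace α N (heis B h i m *
        (polyField B ε h (MvPolynomial.pderiv i Q)).ncoeff p) =
      ∑ i, blockTrace α N ((polyField B ε h (MvPolynomial.pderiv i Q)).ncoeff p *
        heis B h i m) := by
    intro N m p
    have h1 : ∑ i, heis B h i m * (polyField B ε h (MvPolynomial.pderiv i Q)).ncoeff p =
        ∑ i, (polyField B ε h (MvPolynomial.pderiv i Q)).ncoeff p * heis B h i m := by
      have h2 : ∑ i, (polyField B ε h (MvPolynomial.pderiv i (MvPolynomial.pderiv i Q))).ncoeff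
          (p + m - 1) = 0 := by
        rw [← Finset.sum_apply, ← map_sum, ← map_sum, hΔ, map_zero, map_zero, Pi.zero_apply]
      refine LinearMap.ext fun x => ?_
      have h3 := congrArg (fun T : Module.End ℂ (Space L d) => (m : ℂ) • T x) h2
      simp only [LinearMap.sum_apply, LinearMap.zero_apply, smul_zero, Finset.smul_sum] at h3
      simp only [LinearMap.sum_apply, Module.End.mul_apply,
        heis_polyField_commutator B h hε _ m _ p x, Finset.sum_add_distrib, h3, add_zero]
    rw [← map_sum, ← map_sum, h1]
  constructor
  · refine eq_zero_of_shift (D := fun N => ∑ i, blockTrace α N (heis B h i (-n) *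
        (polyField B ε h (MvPolynomial.pderiv i Q)).ncoeff (k - 1 + n))) hn
      (fun N hN => Finset.sum_eq_zero fun i _ => blockTrace_of_neg α hN _) (fun N => ?_) N
    rw [hcomm (N - n)]
    refine Finset.sum_congr rfl fun i _ => blockTrace_comp_comm (fun x hx => ?_) (fun x hx => ?_)
    · convert polyField_mem_block B h hε (hdQ i) (k - 1 + n) hx using 2
      ring
    · convert heis_mem_block B h i (-n) hx using 2
      ring
  · refine eq_zero_of_shift (D := fun N => ∑ i, blockTrace α N
        ((polyField B ε h (MvPolynomial.pderiv i Q)).ncoeff (k - 1 - n) * heis B h i n)) hn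
      (fun N hN => Finset.sum_eq_zero fun i _ => blockTrace_of_neg α hN _) (fun N => ?_) N
    rw [← hcomm (N - n)]
    refine Finset.sum_congr rfl fun i _ => blockTrace_comp_comm (fun x hx => ?_) (fun x hx => ?_)
    · exact heis_mem_block B h i n hx
    · convert polyField_mem_block B h hε (hdQ i) (k - 1 - n) hx using 2
      ring

theorem blockTrace_mul_heis_zero (T : Module.End ℂ (Space L d)) (i : Fin d) (α : L) (N : ℤ) :
    blockTrace α N (T * heis B h i 0) = pairing B h i α * blockTrace α N T := by
  rw [blockTrace_apply, blockTrace_apply, Finset.mul_sum]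
  refine Finset.sum_congr rfl fun μ _ => ?_
  rw [Module.End.mul_apply, heis_zero_single, ← Finsupp.smul_single, map_smul, map_smul,
    smul_eq_mul]

/-- The trace of the zero mode of `v_Q` over `M(1)_N ⊗ e^α` is `Q(α) dim M(1)_N`. -/
theorem blockTrace_zeroMode (hε : ∀ β, ε 0 β = 1) {k : ℕ} {Q : MvPolynomial (Fin d) ℂ}
    (hQ : Q.IsHomogeneous k)
    (hΔ : ∑ i, MvPolynomial.pderiv i (MvPolynomial.pderiv i Q) = 0) (α : L) (N : ℤ) :
    blockTrace α N ((polyField B ε h Q).ncoeff (k - 1)) =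
      MvPolynomial.eval (fun i => pairing B h i α) Q * (wtFinset d N).card := by
  induction k generalizing Q with
  | zero =>
    rw [← MvPolynomial.totalDegree_zero_iff_isHomogeneous,
      MvPolynomial.totalDegree_eq_zero_iff_eq_C] at hQ
    rw [hQ, blockTrace_apply, MvPolynomial.eval_C]
    simp [ncoeff_polyField_C B h hε, mul_comm]
  | succ k ih =>
    have hdQ : ∀ i, (MvPolynomial.pderiv i Q).IsHomogeneous k := fun i => hQ.pderiv
    have hdΔ : ∀ i, ∑ j, MvPolynomial.pderiv j (MvPolynomial.pderiv j
        (MvPolynomial.pderiv i Q)) = 0 := by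
      intro i
      rw [← map_zero (MvPolynomial.pderiv i), ← hΔ, map_sum]
      refine Finset.sum_congr rfl fun j _ => ?_
      rw [pderiv_comm j i, pderiv_comm j i]
    have hE := hQ.sum_X_mul_pderiv
    have hM : ∀ᶠ M : ℕ in Filter.atTop, 0 < M ∧ ∀ i ∈ (Finset.univ : Finset (Fin d)),
        ∀ μ ∈ wtFinset d N, (polyField B ε h (MvPolynomial.X i * MvPolynomial.pderiv i Q)).ncoeff k
          (Finsupp.single α (MvPolynomial.monomial μ 1)) = _ :=
      (Filter.eventually_gt_atTop 0).and <| (Filter.eventually_all_finset _).2 fun i _ =>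
        (Filter.eventually_all_finset _).2 fun μ _ => eventually_polyField_X_mul B ε h i
          (MvPolynomial.pderiv i Q) k (Finsupp.single α (MvPolynomial.monomial μ 1))
    obtain ⟨M, hM0, hM⟩ := hM.exists
    have h1 : ∀ i, blockTrace α N
        ((polyField B ε h (MvPolynomial.X i * MvPolynomial.pderiv i Q)).ncoeff k) =
        ∑ j ∈ Finset.range M,
          (blockTrace α N (heis B h i (-(j : ℤ) - 1) *
            (polyField B ε h (MvPolynomial.pderiv i Q)).ncoeff (k + j)) +
          blockTrace α N ((polyField B ε h (MvPolynomial.pderiv i Q)).ncoeff (k - j - 1) *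
            heis B h i (j : ℤ))) := by
      intro i
      simp only [blockTrace_apply, ← Finset.sum_add_distrib]
      rw [Finset.sum_comm]
      refine Finset.sum_congr rfl fun μ hμ => ?_
      rw [hM i (Finset.mem_univ i) μ hμ, map_sum]
      refine Finset.sum_congr rfl fun j _ => ?_
      rw [map_add, Module.End.mul_apply, Module.End.mul_apply]
    have h2 : ((k : ℂ) + 1) * blockTrace α N ((polyField B ε h Q).ncoeff k) =
        ((k : ℂ) + 1) *
          (MvPolynomial.eval (fun i => pairing B h i α) Q * (wtFinset d N).card) := by
      have hE' : ((k : ℂ) + 1) • Q = ∑ i, MvPolynomial.X i * MvPolynomial.pderiv i Q := by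
        rw [hE, ← Nat.cast_smul_eq_nsmul ℂ, Nat.cast_succ]
      have hL : ((k : ℂ) + 1) * blockTrace α N ((polyField B ε h Q).ncoeff k) =
          ∑ i, blockTrace α N
            ((polyField B ε h (MvPolynomial.X i * MvPolynomial.pderiv i Q)).ncoeff k) := by
        rw [← smul_eq_mul, ← map_smul, ← Pi.smul_apply, ← map_smul, ← map_smul, hE', map_sum,
          map_sum, Finset.sum_apply, map_sum]
      have hR : ((k : ℂ) + 1) * MvPolynomial.eval (fun i => pairing B h i α) Q =
          ∑ i, pairing B h i α *
            MvPolynomial.eval (fun i => pairing B h i α) (MvPolynomial.pderiv i Q) := by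
        rw [← MvPolynomial.smul_eval, hE', map_sum]
        simp only [map_mul, MvPolynomial.eval_X]
      rw [hL, ← mul_assoc, hR, Finset.sum_congr rfl fun i _ => h1 i, Finset.sum_comm,
        Finset.sum_mul]
      rw [Finset.sum_eq_single_of_mem 0 (Finset.mem_range.2 hM0)]
      · rw [Finset.sum_add_distrib]
        have h3 := (sum_blockTrace_heis_eq_zero B h hε hQ hΔ α (n := 1) one_pos N).1
        simp only [sub_add_cancel] at h3
        simp only [Nat.cast_zero, neg_zero, zero_sub, add_zero, sub_zero]
        rw [h3, zero_add]
        refine Finset.sum_congr rfl fun i _ => ?_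
        rw [blockTrace_mul_heis_zero, ih (hdQ i) (hdΔ i), mul_assoc]
      · intro j _ hj
        rw [Finset.sum_add_distrib]
        have h3 := (sum_blockTrace_heis_eq_zero B h hε hQ hΔ α (n := j + 1) (by omega) N).1
        have h4 := (sum_blockTrace_heis_eq_zero B h hε hQ hΔ α (n := j) (by omega) N).2
        rw [show (k : ℤ) - 1 + (j + 1) = k + j by ring, show -((j : ℤ) + 1) = -j - 1 by ring] at h3
        rw [show (k : ℤ) - 1 - j = k - j - 1 by ring] at h4
        rw [h3, h4, add_zero]
    rw [show (((k + 1 : ℕ) : ℤ) - 1) = k by push_cast; ring]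
    exact mul_left_cancel₀ (Nat.cast_add_one_ne_zero k) h2

end Trace

/-! ### Eigenspaces of diagonal operators -/

section Diagonal

variable {I V : Type*} [AddCommGroup V] [Module ℂ V] (b : Module.Basis I ℂ V) {w : I → ℤ}
  {T : Module.End ℂ V}

theorem mem_eigenspace_iff_repr (hT : ∀ i, T (b i) = (w i : ℂ) • b i) (n : ℤ) (x : V) :
    x ∈ Module.End.eigenspace T (n : ℂ) ↔ b.repr x ∈ Finsupp.supported ℂ ℂ {i | w i = n} := by
  have hrepr : ∀ i, b.repr (T x) i = (w i : ℂ) * b.repr x i := by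
    intro i
    have h1 : b.coord i ∘ₗ T = (w i : ℂ) • b.coord i := by
      refine b.ext fun j => ?_
      rw [LinearMap.comp_apply, hT, map_smul, LinearMap.smul_apply, smul_eq_mul, smul_eq_mul,
        b.coord_apply, b.repr_self]
      rcases eq_or_ne j i with rfl | hij
      · rfl
      · rw [Finsupp.single_eq_of_ne hij.symm, mul_zero, mul_zero]
    exact congrArg (fun F : V →ₗ[ℂ] ℂ => F x) h1
  rw [Module.End.mem_eigenspace_iff, Finsupp.mem_supported]
  constructor
  · intro hx i hi
    have h1 := hrepr i
    rw [hx, map_smul, Finsupp.smul_apply, smul_eq_mul] at h1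
    have h2 := mul_right_cancel₀ (Finsupp.mem_support_iff.1 (Finset.mem_coe.1 hi)) h1
    exact_mod_cast h2.symm
  · intro hx
    refine b.repr.injective (Finsupp.ext fun i => ?_)
    rw [hrepr, map_smul, Finsupp.smul_apply, smul_eq_mul]
    by_cases hi : b.repr x i = 0
    · rw [hi, mul_zero, mul_zero]
    · have h2 : w i = n := hx (Finset.mem_coe.2 (Finsupp.mem_support_iff.2 hi))
      rw [h2]

/-- The members of a basis of eigenvectors with eigenvalue `n`, as a basis of the eigenspace. -/
noncomputable def eigenspaceBasis (hT : ∀ i, T (b i) = (w i : ℂ) • b i) (n : ℤ) :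
    Module.Basis {i | w i = n} ℂ (Module.End.eigenspace T (n : ℂ)) :=
  .ofRepr <| (b.repr.ofSubmodules _ (Finsupp.supported ℂ ℂ {i | w i = n}) (by
    ext y
    rw [Submodule.mem_map]
    constructor
    · rintro ⟨x, hx, rfl⟩
      exact (mem_eigenspace_iff_repr b hT n x).1 hx
    · intro hy
      exact ⟨b.repr.symm y, (mem_eigenspace_iff_repr b hT n _).2 (by simpa using hy),
        by simp⟩)).trans
    (Finsupp.supportedEquivFinsupp _)

theorem eigenspaceBasis_repr (hT : ∀ i, T (b i) = (w i : ℂ) • b i) (n : ℤ)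
    (x : Module.End.eigenspace T (n : ℂ)) (i : {i | w i = n}) :
    (eigenspaceBasis b hT n).repr x i = b.repr x i := rfl

theorem coe_eigenspaceBasis (hT : ∀ i, T (b i) = (w i : ℂ) • b i) (n : ℤ) (i : {i | w i = n}) :
    ((eigenspaceBasis b hT n i : Module.End.eigenspace T (n : ℂ)) : V) = b i := by
  classical
  have hmem : b i ∈ Module.End.eigenspace T (n : ℂ) := by
    rw [Module.End.mem_eigenspace_iff, hT, i.2]
  have h1 : eigenspaceBasis b hT n i = ⟨b i, hmem⟩ := by
    refine (eigenspaceBasis b hT n).repr.injective (Finsupp.ext fun j => ?_)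
    rw [Module.Basis.repr_self, eigenspaceBasis_repr, b.repr_self, Finsupp.single_apply,
      Finsupp.single_apply]
    simp only [Subtype.ext_iff]
  rw [h1]

theorem finiteDimensional_eigenspace (hT : ∀ i, T (b i) = (w i : ℂ) • b i) (n : ℤ)
    (hfin : {i | w i = n}.Finite) :
    FiniteDimensional ℂ (Module.End.eigenspace T (n : ℂ)) :=
  have := hfin.to_subtype
  (eigenspaceBasis b hT n).finiteDimensional_of_finite

theorem trace_restrict_eigenspace (hT : ∀ i, T (b i) = (w i : ℂ) • b i) (n : ℤ)
    (hfin : {i | w i = n}.Finite) (A : Module.End ℂ V)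
    (hA : ∀ x ∈ Module.End.eigenspace T (n : ℂ), A x ∈ Module.End.eigenspace T (n : ℂ)) :
    LinearMap.trace ℂ (Module.End.eigenspace T (n : ℂ)) (A.restrict hA) =
      ∑ i ∈ hfin.toFinset, b.repr (A (b i)) i := by
  classical
  have := hfin.fintype
  rw [LinearMap.trace_eq_matrix_trace ℂ (eigenspaceBasis b hT n), Matrix.trace,
    Finset.sum_subtype hfin.toFinset (p := fun i => i ∈ {i | w i = n})
      fun i => hfin.mem_toFinset]
  refine Finset.sum_congr rfl fun i _ => ?_
  rw [Matrix.diag_apply, LinearMap.toMatrix_apply, eigenspaceBasis_repr,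
    LinearMap.coe_restrict_apply, coe_eigenspaceBasis]

end Diagonal

/-! ### The Virasoro operators -/

section Virasoro

variable {L : Type*} [AddCommGroup L] {d : ℕ}
variable (B : LinearMap.BilinForm ℤ L) {ε : L → L → ℤˣ} (h : Fin d → ℂ ⊗[ℤ] L)

theorem virasoro_eq (n : ℤ) : virasoro B ε h n = (polyField B ε h (MvPolynomial.C (1 / 2) *
    ∑ i, MvPolynomial.X i ^ 2)).ncoeff (n + 1) := by
  have h1 : omega L d = vec L (MvPolynomial.C (1 / 2) * ∑ i, MvPolynomial.X i ^ 2) := by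
    simp only [omega, vec, map_mul, map_sum, map_pow, MvPolynomial.aeval_X, MvPolynomial.aeval_C,
      MvPolynomial.algebraMap_eq]
  rw [virasoro, h1, polyField_apply]

/-- `L(n) = (1 / 2) ∑_i :h_i h_i:(n + 1)`. -/
theorem eventually_virasoro (hε : ∀ β, ε 0 β = 1) (n : ℤ) (x : Space L d) :
    ∀ᶠ M : ℕ in Filter.atTop, virasoro B ε h n x = (1 / 2 : ℂ) • ∑ i, ∑ j ∈ Finset.range M,
      (heis B h i (-(j : ℤ) - 1) (heis B h i (n + 1 + j) x) +
        heis B h i (n - j) (heis B h i (j : ℤ) x)) := by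
  have h1 := (Filter.eventually_all_finset (Finset.univ : Finset (Fin d))).2 fun i _ =>
    eventually_polyField_X_mul B ε h i (MvPolynomial.X i) (n + 1) x
  filter_upwards [h1] with M hM
  rw [virasoro_eq, ← MvPolynomial.smul_eq_C_mul, map_smul, ncoeff_smul_apply, map_sum, map_sum,
    Finset.sum_apply, LinearMap.sum_apply]
  congr 1
  refine Finset.sum_congr rfl fun i hi => ?_
  rw [pow_two, hM i hi]
  refine Finset.sum_congr rfl fun j _ => ?_
  rw [ncoeff_polyField_X B h hε, ncoeff_polyField_X B h hε,
    show n + 1 - (j : ℤ) - 1 = n - j by ring]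

/-- `[h_i(m), L(0)] = m h_i(m)`. -/
theorem virasoro_zero_heis (hε : ∀ β, ε 0 β = 1) (i : Fin d) (m : ℤ) (x : Space L d) :
    virasoro B ε h 0 (heis B h i m x) =
      heis B h i m (virasoro B ε h 0 x) - (m : ℂ) • heis B h i m x := by
  have hd : MvPolynomial.pderiv i (MvPolynomial.C (1 / 2) * ∑ i, MvPolynomial.X i ^ 2) =
      (MvPolynomial.X i : MvPolynomial (Fin d) ℂ) := by
    classical
    rw [MvPolynomial.pderiv_C_mul, map_sum, Finset.sum_eq_single_of_mem i (Finset.mem_univ i)]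
    · rw [MvPolynomial.pderiv_pow, MvPolynomial.pderiv_X_self, Nat.cast_ofNat, mul_one,
        ← mul_assoc, ← map_ofNat MvPolynomial.C 2, ← map_mul]
      norm_num
    · intro j _ hj
      rw [MvPolynomial.pderiv_pow, MvPolynomial.pderiv_X_of_ne hj, mul_zero]
  rw [virasoro_eq, heis_polyField_commutator B h hε i m, hd, ncoeff_polyField_X B h hε,
    show (0 : ℤ) + 1 + m - 1 = m by ring, add_sub_cancel_right]

/-- The operators `h_i(n)` with `n > 0` annihilate `e^α`. -/
theorem heis_pos_single_one (i : Fin d) {n : ℤ} (hn : 0 < n) (α : L) :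
    heis B h i n (Finsupp.single α 1) = 0 := by
  obtain ⟨r, rfl⟩ : ∃ r : ℕ, n = (r : ℤ) + 1 := ⟨(n - 1).toNat, by omega⟩
  rw [heis_pos_single, MvPolynomial.pderiv_one, smul_zero, Finsupp.single_zero]

theorem virasoro_zero_single_one (hε : ∀ β, ε 0 β = 1) (α : L) :
    virasoro B ε h 0 (Finsupp.single α 1) =
      ((∑ i, pairing B h i α ^ 2) / 2) • Finsupp.single α 1 := by
  obtain ⟨M, hM, hM0⟩ := ((eventually_virasoro B h hε 0 (Finsupp.single α 1)).and
    (Filter.eventually_gt_atTop 0)).exists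
  rw [hM, show (∑ i, pairing B h i α ^ 2) / 2 = 1 / 2 * ∑ i, pairing B h i α ^ 2 by ring, mul_smul,
    Finset.sum_smul]
  congr 1
  refine Finset.sum_congr rfl fun i _ => ?_
  rw [Finset.sum_eq_single_of_mem 0 (Finset.mem_range.2 hM0)]
  · rw [heis_pos_single_one B h i (by omega), map_zero, zero_add, Nat.cast_zero, sub_zero,
      heis_zero_single, heis_zero_single, smul_smul, ← Finsupp.smul_single, pow_two]
  · intro j _ hj
    rw [heis_pos_single_one B h i (by omega), heis_pos_single_one B h i (by omega), map_zero,
      map_zero, add_zero]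

/-- `h^μ ⊗ e^α` is an eigenvector of `L(0)` of eigenvalue `∑_i (h_i, α)² / 2 + wt μ`. -/
theorem virasoro_zero_single_monomial (hε : ∀ β, ε 0 β = 1) (α : L) (μ : Fin d × ℕ →₀ ℕ) :
    virasoro B ε h 0 (Finsupp.single α (MvPolynomial.monomial μ 1)) =
      ((∑ i, pairing B h i α ^ 2) / 2 + (wt μ : ℂ)) •
        Finsupp.single α (MvPolynomial.monomial μ 1) := by
  set c := (∑ i, pairing B h i α ^ 2) / 2 with hc
  -- multiplication by `h_i(-(r + 1))` raises the eigenvalue by `r + 1`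
  have hstep : ∀ (s : Fin d × ℕ) (ν : Fin d × ℕ →₀ ℕ),
      virasoro B ε h 0 (Finsupp.single α (MvPolynomial.monomial ν 1)) =
        (c + (wt ν : ℂ)) • Finsupp.single α (MvPolynomial.monomial ν 1) →
      virasoro B ε h 0 (Finsupp.single α (MvPolynomial.monomial (Finsupp.single s 1 + ν) 1)) =
        (c + (wt (Finsupp.single s 1 + ν) : ℂ)) •
          Finsupp.single α (MvPolynomial.monomial (Finsupp.single s 1 + ν) 1) := by
    rintro ⟨i, r⟩ ν hν
    have h1 : (Finsupp.single α (MvPolynomial.monomial (Finsupp.single (i, r) 1 + ν) 1) :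
        Space L d) =
        heis B h i (-(r : ℤ) - 1) (Finsupp.single α (MvPolynomial.monomial ν 1)) := by
      rw [heis_neg_single, MvPolynomial.X, MvPolynomial.monomial_mul, one_mul]
    rw [h1, virasoro_zero_heis B h hε, hν, map_smul, ← sub_smul, wt_add, wt_single_one]
    congr 1
    push_cast
    ring
  have hadd : ∀ μ ν : Fin d × ℕ →₀ ℕ,
      virasoro B ε h 0 (Finsupp.single α (MvPolynomial.monomial ν 1)) =
        (c + (wt ν : ℂ)) • Finsupp.single α (MvPolynomial.monomial ν 1) →
      virasoro B ε h 0 (Finsupp.single α (MvPolynomial.monomial (μ + ν) 1)) =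
        (c + (wt (μ + ν) : ℂ)) • Finsupp.single α (MvPolynomial.monomial (μ + ν) 1) := by
    intro μ
    induction μ using Finsupp.induction_linear with
    | zero => simp
    | add μ₁ μ₂ h1 h2 =>
      intro ν hν
      rw [add_assoc]
      exact h1 _ (h2 _ hν)
    | single s n =>
      induction n with
      | zero => simp
      | succ n ih =>
        intro ν hν
        rw [add_comm n 1, Finsupp.single_add, add_assoc]
        exact hstep s _ (ih ν hν)
  have h0 := hadd μ 0 (by
    rw [MvPolynomial.monomial_zero', map_one, wt_zero, Nat.cast_zero, add_zero]
    exact virasoro_zero_single_one B h hε α)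
  rwa [add_zero] at h0

theorem virasoro_zero_of_mem_block (hε : ∀ β, ε 0 β = 1) {α : L} {N : ℤ} {x : Space L d}
    (hx : x ∈ block d α N) :
    virasoro B ε h 0 x = ((∑ i, pairing B h i α ^ 2) / 2 + (N : ℂ)) • x := by
  rw [eq_sum_of_mem_block hx, map_sum, Finset.smul_sum]
  refine Finset.sum_congr rfl fun μ hμ => ?_
  rw [map_smul, virasoro_zero_single_monomial B h hε, smul_comm, ← mem_wtFinset.1 hμ,
    Int.cast_natCast]

variable (L) in
theorem vec_mem_block {k : ℕ} {P : MvPolynomial (Fin d) ℂ} (hP : P.IsHomogeneous k) :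
    vec L P ∈ block d 0 k := by
  refine single_mem_block 0 fun μ hμ => ?_
  rw [aeval_X_zero] at hμ
  obtain ⟨ν, rfl, hν⟩ := MvPolynomial.coeff_rename_ne_zero _ _ _ hμ
  have h1 := hP hν
  rw [Finsupp.weight_apply] at h1
  rw [wt, Finsupp.weight_apply, Finsupp.sum_mapDomain_index
    (h := fun (s : Fin d × ℕ) n => n • (s.2 + 1)) (fun _ => zero_smul _ _)
    (fun _ _ _ => add_smul _ _ _), ← h1]
  rfl

theorem heis_vec_of_ne_one (i : Fin d) {n : ℤ} (hn : 0 ≤ n) (hn1 : n ≠ 1)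
    (P : MvPolynomial (Fin d) ℂ) : heis B h i n (vec L P) = 0 := by
  rw [vec, aeval_X_zero]
  rcases hn.eq_or_lt with rfl | hn
  · rw [heis_zero_single, pairing_zero_right, zero_smul, Finsupp.single_zero]
  · obtain ⟨r, rfl⟩ : ∃ r : ℕ, n = (r : ℤ) + 1 := ⟨(n - 1).toNat, by omega⟩
    rw [heis_pos_single, MvPolynomial.pderiv_eq_zero_of_notMem_vars, smul_zero,
      Finsupp.single_zero]
    intro hmem
    classical
    have := MvPolynomial.vars_rename _ _ hmem
    simp only [Finset.mem_image, Prod.mk.injEq] at this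
    omega

theorem heis_one_vec (i : Fin d) (P : MvPolynomial (Fin d) ℂ) :
    heis B h i 1 (vec L P) = vec L (MvPolynomial.pderiv i P) := by
  have h1 := heis_pos_single B h i 0 0 (MvPolynomial.rename (fun i => (i, 0)) P)
  rw [Nat.cast_zero, zero_add, MvPolynomial.pderiv_rename (fun a b hab => (Prod.mk.inj hab).1),
    Nat.cast_zero, zero_add, one_smul] at h1
  rw [vec, aeval_X_zero, h1, vec, aeval_X_zero]

/-- Only `L(2)` needs harmonicity: `L(2) v_P = v_{ΔP} / 2`. -/
theorem virasoro_pos_vec (hε : ∀ β, ε 0 β = 1) {P : MvPolynomial (Fin d) ℂ}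
    (hΔ : ∑ i, MvPolynomial.pderiv i (MvPolynomial.pderiv i P) = 0) {n : ℤ} (hn : 0 < n) :
    virasoro B ε h n (vec L P) = 0 := by
  obtain ⟨M, hM, hM1⟩ := ((eventually_virasoro B h hε n (vec L P)).and
    (Filter.eventually_gt_atTop 1)).exists
  rw [hM]
  have h1 : ∀ i, ∑ j ∈ Finset.range M,
      (heis B h i (-(j : ℤ) - 1) (heis B h i (n + 1 + j) (vec L P)) +
        heis B h i (n - j) (heis B h i (j : ℤ) (vec L P))) =
      heis B h i (n - 1) (vec L (MvPolynomial.pderiv i P)) := by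
    intro i
    rw [Finset.sum_eq_single_of_mem 1 (Finset.mem_range.2 hM1)]
    · rw [heis_vec_of_ne_one B h i (by omega) (by omega), map_zero, zero_add, Nat.cast_one,
        heis_one_vec]
    · intro j _ hj
      rw [heis_vec_of_ne_one B h i (by omega) (by omega), map_zero, zero_add,
        heis_vec_of_ne_one B h i (by omega) (by omega), map_zero]
  simp only [h1]
  rcases eq_or_ne n 2 with rfl | hn2
  · have h2 : ∑ i, vec L (MvPolynomial.pderiv i (MvPolynomial.pderiv i P)) = 0 := by
      simp only [vec, ← Finsupp.lsingle_apply (R := ℂ)]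
      rw [← map_sum, ← map_sum, hΔ, map_zero, map_zero]
    norm_num
    simp only [heis_one_vec, h2]
  · simp only [heis_vec_of_ne_one B h _ (show 0 ≤ n - 1 by omega) (show n - 1 ≠ 1 by omega)]
    simp

end Virasoro

/-! ### Convergence of the theta series -/

section Lattice

variable {L : Type*} [AddCommGroup L] {B : LinearMap.BilinForm ℤ L}

/-- A positive definite lattice contains vectors that form an orthogonal basis of its
rational span. -/
theorem exists_orthogonal_vectors [Module.Free ℤ L] [Module.Finite ℤ L] (hB : IsPosDefEven B) :
    ∃ (n : ℕ) (e : Fin n → L), (∀ j, 0 < B (e j) (e j)) ∧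
      (∀ x, (B x x : ℝ) = ∑ j, (B x (e j) : ℝ) ^ 2 / B (e j) (e j)) ∧
      ∀ (f : L →+ ℂ) (x : L), f x = ∑ j, ((B x (e j) : ℂ) / B (e j) (e j)) * f (e j) := by
  set Bq := B.baseChange ℚ with hBq
  have hsymm : LinearMap.IsSymm Bq :=
    LinearMap.BilinForm.IsSymm.baseChange ℚ ⟨hB.symm⟩
  have : Invertible (2 : ℚ) := invertibleOfNonzero two_ne_zero
  obtain ⟨v, hv⟩ := LinearMap.BilinForm.exists_orthogonal_basis hsymm
  -- clear denominators
  choose p hp using fun j => IsLocalizedModule.surj (nonZeroDivisors ℤ)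
    (TensorProduct.mk ℤ ℚ L 1) (v j)
  have hunit : ∀ j, IsUnit (((p j).2 : ℤ) : ℚ) := fun j =>
    isUnit_iff_ne_zero.2 (Int.cast_ne_zero.2 (nonZeroDivisors.ne_zero (p j).2.2))
  set u := v.isUnitSMul hunit with hu
  set e : Fin (Module.finrank ℚ (ℚ ⊗[ℤ] L)) → L := fun j => (p j).1 with he
  have hue : ∀ j, u j = (1 : ℚ) ⊗ₜ[ℤ] e j := by
    intro j
    rw [hu, Module.Basis.isUnitSMul_apply, Int.cast_smul_eq_zsmul]
    exact hp j
  have hBe : ∀ x y : L, Bq ((1 : ℚ) ⊗ₜ[ℤ] x) ((1 : ℚ) ⊗ₜ[ℤ] y) = B x y := by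
    intro x y
    rw [hBq, LinearMap.BilinForm.baseChange_tmul]
    simp
  have hpos : ∀ j, 0 < B (e j) (e j) := by
    intro j
    refine hB.pos _ fun h0 => u.ne_zero j ?_
    rw [hue, h0, TensorProduct.tmul_zero]
  have hpos' : ∀ j, (B (e j) (e j) : ℚ) ≠ 0 := fun j => Int.cast_ne_zero.2 (hpos j).ne'
  have hortho : ∀ i j, i ≠ j → Bq (u i) (u j) = 0 := by
    intro i j hij
    rw [hu, Module.Basis.isUnitSMul_apply, Module.Basis.isUnitSMul_apply, map_smul,
      LinearMap.map_smul₂, LinearMap.isOrthoᵢ_def.1 hv i j hij, smul_zero, smul_zero]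
  have hcoord : ∀ x : L, ∀ j, u.repr ((1 : ℚ) ⊗ₜ[ℤ] x) j = (B x (e j) : ℚ) / B (e j) (e j) := by
    intro x j
    have h1 : Bq ((1 : ℚ) ⊗ₜ[ℤ] x) (u j) =
        u.repr ((1 : ℚ) ⊗ₜ[ℤ] x) j * Bq (u j) (u j) := by
      conv_lhs => rw [← u.sum_repr ((1 : ℚ) ⊗ₜ[ℤ] x)]
      rw [map_sum, LinearMap.sum_apply, Finset.sum_eq_single_of_mem j (Finset.mem_univ j)]
      · rw [LinearMap.map_smul₂, smul_eq_mul]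
      · intro i _ hij
        rw [LinearMap.map_smul₂, hortho i j hij, smul_zero]
    rw [hue, hBe, hBe] at h1
    rw [h1, mul_div_cancel_right₀ _ (hpos' j)]
  have hexp : ∀ x : L, (1 : ℚ) ⊗ₜ[ℤ] x =
      ∑ j, ((B x (e j) : ℚ) / B (e j) (e j)) • ((1 : ℚ) ⊗ₜ[ℤ] e j) := by
    intro x
    conv_lhs => rw [← u.sum_repr ((1 : ℚ) ⊗ₜ[ℤ] x)]
    simp only [hcoord, hue]
  refine ⟨_, e, hpos, fun x => ?_, fun f x => ?_⟩
  · have h1 : (B x x : ℚ) = ∑ j, (B x (e j) : ℚ) ^ 2 / B (e j) (e j) := by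
      rw [← hBe x x]
      conv_lhs => rw [hexp x]
      rw [map_sum]
      refine Finset.sum_congr rfl fun j _ => ?_
      rw [← hexp x, map_smul, hBe, smul_eq_mul]
      ring
    exact_mod_cast congrArg (Rat.cast : ℚ → ℝ) h1
  · have h1 := congrArg (LinearMap.liftBaseChange ℚ f.toIntLinearMap) (hexp x)
    rw [map_sum] at h1
    simp only [map_smul, LinearMap.liftBaseChange_tmul, one_smul, AddMonoidHom.coe_toIntLinearMap,
      Rat.smul_def] at h1
    rw [h1]
    push_cast
    rfl

theorem summable_exp_linear_sub_sq (D : ℝ) {c : ℝ} (hc : 0 < c) :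
    Summable fun m : ℤ => Real.exp (D * |(m : ℝ)| - c * (m : ℝ) ^ 2) := by
  have hgeom : Summable fun n : ℕ => Real.exp ((D + 1) ^ 2 / (4 * c)) * Real.exp (-1) ^ n :=
    (summable_geometric_of_lt_one (Real.exp_nonneg _)
      (Real.exp_lt_one_iff.mpr (by norm_num))).mul_left _
  -- complete the square
  have hle : ∀ (n : ℕ) (m : ℤ), |(m : ℝ)| = n →
      Real.exp (D * |(m : ℝ)| - c * (m : ℝ) ^ 2) ≤
        Real.exp ((D + 1) ^ 2 / (4 * c)) * Real.exp (-1) ^ n := by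
    intro n m hm
    rw [← Real.exp_nat_mul, ← Real.exp_add, Real.exp_le_exp, ← sq_abs (m : ℝ), hm]
    have h1 : (D + 1) ^ 2 / (4 * c) + n * -1 - (D * n - c * (n : ℝ) ^ 2) =
        (2 * c * n - (D + 1)) ^ 2 / (4 * c) := by
      field_simp
      ring
    have h2 : 0 ≤ (2 * c * n - (D + 1)) ^ 2 / (4 * c) := by positivity
    linarith
  refine Summable.of_nat_of_neg ?_ ?_
  · exact hgeom.of_nonneg_of_le (fun _ => Real.exp_nonneg _) fun n => hle n n (by simp)
  · exact hgeom.of_nonneg_of_le (fun _ => Real.exp_nonneg _) fun n => hle n (-n) (by simp)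

theorem summable_prod_pi {n : ℕ} {κ : Type*} {g : Fin n → κ → ℝ} (hg0 : ∀ j m, 0 ≤ g j m)
    (hg : ∀ j, Summable (g j)) : Summable fun m : Fin n → κ => ∏ j, g j (m j) := by
  classical
  refine summable_of_sum_le (fun m => Finset.prod_nonneg fun j _ => hg0 j _)
    (c := ∏ j, ∑' m, g j m) fun u => ?_
  have hu : u ⊆ Fintype.piFinset fun j => u.image fun m => m j := fun m hm =>
    Fintype.mem_piFinset.2 fun j => Finset.mem_image_of_mem _ hm
  calc ∑ m ∈ u, ∏ j, g j (m j)
      ≤ ∑ m ∈ Fintype.piFinset fun j => u.image fun m => m j, ∏ j, g j (m j) :=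
        Finset.sum_le_sum_of_subset_of_nonneg hu fun m _ _ => Finset.prod_nonneg fun j _ => hg0 j _
    _ = ∏ j, ∑ m ∈ u.image fun m => m j, g j m := (Finset.prod_univ_sum _ _).symm
    _ ≤ ∏ j, ∑' m, g j m := Finset.prod_le_prod
        (fun j _ => Finset.sum_nonneg fun m _ => hg0 j m)
        fun j _ => (hg j).sum_le_tsum _ fun m _ => hg0 j m

variable {d : ℕ} (h : Fin d → ℂ ⊗[ℤ] L)

/-- Linear growth is absorbed by `|y| ≤ exp |y|`, so that each monomial of `P` is dominated by a
product of one-variable Gaussian sums in orthogonal coordinates. -/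
theorem summable_thetaTerm [Module.Free ℤ L] [Module.Finite ℤ L] (hB : IsPosDefEven B)
    (P : MvPolynomial (Fin d) ℂ) (τ : ℍ) : Summable (thetaTerm B h P τ) := by
  obtain ⟨n, e, hpos, hsq, hlin⟩ := exists_orthogonal_vectors hB
  have hinj : Function.Injective fun (x : L) (j : Fin n) => B x (e j) := by
    intro x y hxy
    by_contra hne
    have h1 := hB.pos (x - y) (sub_ne_zero.2 hne)
    have h2 := hsq (x - y)
    have h3 : ∀ j, B (x - y) (e j) = 0 := fun j => by
      rw [map_sub, LinearMap.sub_apply, sub_eq_zero]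
      exact congrFun hxy j
    simp only [h3, Int.cast_zero, ne_eq, OfNat.ofNat_ne_zero, not_false_eq_true, zero_pow,
      zero_div, Finset.sum_const_zero, Int.cast_eq_zero] at h2
    omega
  have hcoef : ∀ i, ∃ K : Fin n → ℝ, ∀ x,
      ‖pairing B h i x‖ ≤ ∑ j, K j * |(B x (e j) : ℝ)| := by
    intro i
    refine ⟨fun j => ‖(B (e j) (e j) : ℂ)‖⁻¹ * ‖pairing B h i (e j)‖, fun x => ?_⟩
    have h1 := hlin (AddMonoidHom.mk' (pairing B h i) (pairing_add_right B h i)) x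
    simp only [AddMonoidHom.mk'_apply] at h1
    rw [h1]
    refine (norm_sum_le _ _).trans (Finset.sum_le_sum fun j _ => le_of_eq ?_)
    rw [norm_mul, norm_div, Complex.norm_intCast (B x (e j))]
    ring
  choose K hK using hcoef
  set c := Real.pi * τ.im with hc
  have hc0 : 0 < c := mul_pos Real.pi_pos τ.im_pos
  have hexp : ∀ x : L, ‖Complex.exp (2 * Real.pi * Complex.I * (τ : ℂ) * ((B x x : ℂ) / 2))‖ =
      Real.exp (-(c * B x x)) := by
    intro x
    rw [Complex.norm_exp]
    congr 1
    have h1 : 2 * Real.pi * Complex.I * (τ : ℂ) * ((B x x : ℂ) / 2) =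
        ((Real.pi * (B x x : ℝ) : ℝ) : ℂ) * (Complex.I * (τ : ℂ)) := by
      push_cast
      ring
    rw [h1, Complex.re_ofReal_mul, Complex.I_mul_re, UpperHalfPlane.coe_im]
    ring
  have hmono : ∀ μ : Fin d →₀ ℕ, Summable fun x : L => (∏ i, pairing B h i x ^ μ i) *
      Complex.exp (2 * Real.pi * Complex.I * (τ : ℂ) * ((B x x : ℂ) / 2)) := by
    intro μ
    have hsum := (summable_prod_pi (fun (j : Fin n) (m : ℤ) => Real.exp_nonneg _) fun j =>
      summable_exp_linear_sub_sq (∑ i, μ i * K i j)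
        (c := c / B (e j) (e j)) (div_pos hc0 (Int.cast_pos.2 (hpos j)))).comp_injective hinj
    refine hsum.of_norm_bounded fun x => ?_
    have h1 : ‖∏ i, pairing B h i x ^ μ i‖ ≤
        Real.exp (∑ i, μ i * ∑ j, K i j * |(B x (e j) : ℝ)|) := by
      rw [norm_prod, Real.exp_sum]
      refine Finset.prod_le_prod (fun _ _ => norm_nonneg _) fun i _ => ?_
      rw [norm_pow, Real.exp_nat_mul]
      refine pow_le_pow_left₀ (norm_nonneg _) ?_ _
      exact (hK i x).trans ((le_add_of_nonneg_right zero_le_one).trans (Real.add_one_le_exp _))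
    rw [norm_mul, hexp]
    refine (mul_le_mul_of_nonneg_right h1 (Real.exp_nonneg _)).trans (le_of_eq ?_)
    simp only [Function.comp_apply]
    rw [← Real.exp_add, ← Real.exp_sum, hsq x]
    congr 1
    simp only [Finset.mul_sum, Finset.sum_mul, Finset.sum_sub_distrib]
    rw [Finset.sum_comm, ← sub_eq_add_neg]
    congr 1
    · exact Finset.sum_congr rfl fun j _ => Finset.sum_congr rfl fun i _ => by ring
    · exact Finset.sum_congr rfl fun j _ => by ring
  have heq : thetaTerm B h P τ = fun x => ∑ μ ∈ P.support, MvPolynomial.coeff μ P *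
      ((∏ i, pairing B h i x ^ μ i) *
        Complex.exp (2 * Real.pi * Complex.I * (τ : ℂ) * ((B x x : ℂ) / 2))) := by
    funext x
    rw [thetaTerm, MvPolynomial.eval_eq', Finset.sum_mul]
    exact Finset.sum_congr rfl fun μ _ => mul_assoc _ _ _
  rw [heq]
  exact summable_sum fun μ _ => (hmono μ).mul_left _

/-- Parseval's identity for the orthonormal basis `h`. -/
theorem sum_pairing_sq (h : Module.Basis (Fin d) ℂ (ℂ ⊗[ℤ] L))
    (hh : ∀ i j, B.baseChange ℂ (h i) (h j) = if i = j then 1 else 0) (α : L) :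
    ∑ i, pairing B h i α ^ 2 = B α α := by
  have h1 : ∀ i, pairing B h i α = h.repr ((1 : ℂ) ⊗ₜ[ℤ] α) i := by
    intro i
    rw [pairing]
    conv_lhs => rw [← h.sum_repr ((1 : ℂ) ⊗ₜ[ℤ] α)]
    rw [map_sum, Finset.sum_eq_single_of_mem i (Finset.mem_univ i)]
    · rw [map_smul, hh, if_pos rfl, smul_eq_mul, mul_one]
    · intro j _ hj
      rw [map_smul, hh, if_neg hj.symm, smul_zero]
  have h2 : B.baseChange ℂ ((1 : ℂ) ⊗ₜ[ℤ] α) ((1 : ℂ) ⊗ₜ[ℤ] α) = B α α := by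
    rw [LinearMap.BilinForm.baseChange_tmul]
    simp
  have h3 : ∀ y, B.baseChange ℂ ((1 : ℂ) ⊗ₜ[ℤ] α) y =
      ∑ i, pairing B h i α * B.baseChange ℂ (h i) y := by
    intro y
    conv_lhs => rw [← h.sum_repr ((1 : ℂ) ⊗ₜ[ℤ] α)]
    rw [map_sum, LinearMap.sum_apply]
    refine Finset.sum_congr rfl fun i _ => ?_
    rw [LinearMap.map_smul₂, smul_eq_mul, h1]
  rw [← h2, h3]
  exact Finset.sum_congr rfl fun i _ => pow_two _

end Lattice

/-! ### The trace function -/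

section TraceFunction

variable {L : Type*} {d : ℕ}

variable (L d) in
/-- The basis of `V_L` given by the vectors `h^μ ⊗ e^α`. -/
noncomputable def spaceBasis : Module.Basis (L × (Fin d × ℕ →₀ ℕ)) ℂ (Space L d) :=
  (Finsupp.basis fun _ : L => MvPolynomial.basisMonomials (Fin d × ℕ) ℂ).reindex
    (Equiv.sigmaEquivProd L _)

theorem spaceBasis_apply (i : L × (Fin d × ℕ →₀ ℕ)) :
    spaceBasis L d i = Finsupp.single i.1 (MvPolynomial.monomial i.2 1) := by
  simp [spaceBasis]

theorem spaceBasis_repr (x : Space L d) (i : L × (Fin d × ℕ →₀ ℕ)) :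
    (spaceBasis L d).repr x i = blockCoeff i.1 i.2 x := by
  rw [spaceBasis, Module.Basis.repr_reindex, Finsupp.mapDomain_equiv_apply]
  rfl

theorem hasSum_mul_pow_wt {t : L → ℂ} {S : ℂ} (ht : HasSum t S) {q : ℂ} (hq : ‖q‖ < 1) :
    HasSum (fun i : L × (Fin d × ℕ →₀ ℕ) => t i.1 * q ^ wt i.2)
      (S * ((∏' n : ℕ, (1 - q ^ (n + 1)))⁻¹) ^ d) := by
  have h2 := hasSum_pow_wt (d := d) hq
  have hm := summable_mul_of_summable_norm (f := t)
    (g := fun μ : Fin d × ℕ →₀ ℕ => q ^ wt μ) ht.summable.norm h2.1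
  have h3 := HasSum.mul ht h2.2 hm
  exact h3

variable [AddCommGroup L]

/-- The weight `(α, α) / 2 + wt μ` of `h^μ ⊗ e^α`; the division is exact in an even lattice. -/
noncomputable def totalWeight (B : LinearMap.BilinForm ℤ L) (i : L × (Fin d × ℕ →₀ ℕ)) : ℤ :=
  B i.1 i.1 / 2 + wt i.2

variable {B : LinearMap.BilinForm ℤ L}

theorem cast_half (hB : IsPosDefEven B) (α : L) : ((B α α / 2 : ℤ) : ℂ) = (B α α : ℂ) / 2 := by
  rw [Int.cast_div (hB.even α).two_dvd (by norm_num), Int.cast_ofNat]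

/-- The contribution `P(α) q ^ ((α, α) / 2 + wt μ)` of `h^μ ⊗ e^α` to the trace function. -/
noncomputable def traceTerm (B : LinearMap.BilinForm ℤ L) (h : Fin d → ℂ ⊗[ℤ] L)
    (P : MvPolynomial (Fin d) ℂ) (τ : ℍ) (i : L × (Fin d × ℕ →₀ ℕ)) : ℂ :=
  MvPolynomial.eval (fun j => pairing B h j i.1) P *
    Complex.exp (2 * Real.pi * Complex.I * (τ : ℂ) * (totalWeight B i : ℂ))

theorem norm_exp_lt_one (τ : ℍ) : ‖Complex.exp (2 * Real.pi * Complex.I * (τ : ℂ))‖ < 1 :=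
  UpperHalfPlane.norm_exp_two_pi_I_lt_one τ

theorem traceTerm_eq (hB : IsPosDefEven B) (h : Fin d → ℂ ⊗[ℤ] L) (P : MvPolynomial (Fin d) ℂ)
    (τ : ℍ) (i : L × (Fin d × ℕ →₀ ℕ)) :
    traceTerm B h P τ i = thetaTerm B h P τ i.1 *
      Complex.exp (2 * Real.pi * Complex.I * (τ : ℂ)) ^ wt i.2 := by
  rw [traceTerm, thetaTerm, ← Complex.exp_nat_mul,
    mul_assoc (MvPolynomial.eval _ P), ← Complex.exp_add, totalWeight,
    Int.cast_add, cast_half hB, Int.cast_natCast]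
  congr 2
  ring

/-- The double series over `α` and `μ` is the product of the theta series and the character of the
Fock space. -/
theorem hasSum_traceTerm [Module.Free ℤ L] [Module.Finite ℤ L] (hB : IsPosDefEven B)
    (h : Fin d → ℂ ⊗[ℤ] L) (P : MvPolynomial (Fin d) ℂ) (τ : ℍ) :
    HasSum (traceTerm B h P τ) (theta B h P τ *
      ((∏' n : ℕ, (1 - Complex.exp (2 * Real.pi * Complex.I * (τ : ℂ)) ^ (n + 1)))⁻¹) ^ d) := by
  have h1 : HasSum (thetaTerm B h P τ) (theta B h P τ) := (summable_thetaTerm h hB P τ).hasSum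
  rw [funext (traceTerm_eq hB h P τ)]
  exact hasSum_mul_pow_wt h1 (norm_exp_lt_one τ)

theorem finite_totalWeight_eq [Module.Free ℤ L] [Module.Finite ℤ L] (hB : IsPosDefEven B)
    (n : ℤ) : {i : L × (Fin d × ℕ →₀ ℕ) | totalWeight B i = n}.Finite := by
  have h1 := (hasSum_traceTerm hB (0 : Fin d → ℂ ⊗[ℤ] L) 1
    UpperHalfPlane.I).summable.tendsto_cofinite_zero
  have hpos : ‖(0 : ℂ)‖ < ‖Complex.exp (2 * Real.pi * Complex.I * (UpperHalfPlane.I : ℂ) *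
      (n : ℂ))‖ := by
    rw [norm_zero]
    exact norm_pos_iff.2 (Complex.exp_ne_zero _)
  have h2 := h1.norm.eventually (gt_mem_nhds hpos)
  rw [Filter.eventually_cofinite] at h2
  refine h2.subset fun i hi => ?_
  change ¬ ‖traceTerm B 0 1 UpperHalfPlane.I i‖ < _
  rw [traceTerm, map_one, one_mul, show totalWeight B i = n from hi]
  exact lt_irrefl _

variable {ε : L → L → ℤˣ} (h : Module.Basis (Fin d) ℂ (ℂ ⊗[ℤ] L))

theorem virasoro_zero_of_mem_block_lattice (hB : IsPosDefEven B) (hε : ∀ β, ε 0 β = 1)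
    (hh : ∀ i j, B.baseChange ℂ (h i) (h j) = if i = j then 1 else 0) {α : L} {N : ℤ}
    {x : Space L d} (hx : x ∈ block d α N) :
    virasoro B ε h 0 x = ((B α α / 2 + N : ℤ) : ℂ) • x := by
  rw [virasoro_zero_of_mem_block B h hε hx, sum_pairing_sq h hh, Int.cast_add, cast_half hB]

theorem virasoro_zero_spaceBasis (hB : IsPosDefEven B) (hε : ∀ β, ε 0 β = 1)
    (hh : ∀ i j, B.baseChange ℂ (h i) (h j) = if i = j then 1 else 0)
    (i : L × (Fin d × ℕ →₀ ℕ)) :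
    virasoro B ε h 0 (spaceBasis L d i) = (totalWeight B i : ℂ) • spaceBasis L d i := by
  rw [spaceBasis_apply]
  exact virasoro_zero_of_mem_block_lattice h hB hε hh
    (single_mem_block i.1 (monomial_mem_fockGrade i.2 1))

theorem zeroMode_mem_weightSpace (hB : IsPosDefEven B) (hε : ∀ β, ε 0 β = 1)
    (hh : ∀ i j, B.baseChange ℂ (h i) (h j) = if i = j then 1 else 0) {k : ℕ}
    {P : MvPolynomial (Fin d) ℂ} (hP : P.IsHomogeneous k) (n : ℤ) :
    ∀ x ∈ weightSpace B ε h n, zeroMode B ε h k (vec L P) x ∈ weightSpace B ε h n := by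
  intro x hx
  have hsupp := (mem_eigenspace_iff_repr (spaceBasis L d)
    (virasoro_zero_spaceBasis h hB hε hh) n x).1 hx
  rw [Finsupp.mem_supported] at hsupp
  rw [← (spaceBasis L d).linearCombination_repr x, Finsupp.linearCombination_apply, Finsupp.sum,
    map_sum]
  refine Submodule.sum_mem _ fun i hi => ?_
  rw [map_smul, spaceBasis_apply]
  refine Submodule.smul_mem _ _ ?_
  have h1 := polyField_mem_block B (ε := ε) h hε hP (k - 1)
    (single_mem_block i.1 (monomial_mem_fockGrade i.2 (1 : ℂ)))
  rw [show (wt i.2 : ℤ) + k - (k - 1) - 1 = wt i.2 by ring] at h1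
  have h2 := virasoro_zero_of_mem_block_lattice h hB hε hh h1
  have h3 : B i.1 i.1 / 2 + (wt i.2 : ℤ) = n := hsupp (Finset.mem_coe.2 hi)
  rw [h3] at h2
  exact Module.End.mem_eigenspace_iff.2 h2

/-- `tr_{V_n} o(v_P) = ∑ P(α)`, summed over the basis vectors `h^μ ⊗ e^α` of weight `n`. -/
theorem trace_zeroMode (hB : IsPosDefEven B) (hε : ∀ β, ε 0 β = 1)
    (hh : ∀ i j, B.baseChange ℂ (h i) (h j) = if i = j then 1 else 0) {k : ℕ}
    {P : MvPolynomial (Fin d) ℂ} (hP : P.IsHomogeneous k)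
    (hΔ : ∑ i, MvPolynomial.pderiv i (MvPolynomial.pderiv i P) = 0) (n : ℤ)
    (hfin : {i : L × (Fin d × ℕ →₀ ℕ) | totalWeight B i = n}.Finite)
    (hpres : ∀ x ∈ weightSpace B ε h n, zeroMode B ε h k (vec L P) x ∈ weightSpace B ε h n) :
    LinearMap.trace ℂ (weightSpace B ε h n) ((zeroMode B ε h k (vec L P)).restrict hpres) =
      ∑ i ∈ hfin.toFinset, MvPolynomial.eval (fun j => pairing B h j i.1) P := by
  classical
  have h1 := trace_restrict_eigenspace (spaceBasis L d) (virasoro_zero_spaceBasis h hB hε hh) n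
    hfin (zeroMode B ε h k (vec L P)) hpres
  refine h1.trans ?_
  -- sort the basis vectors by the lattice vector `α`
  have hprod : ∀ i : L × (Fin d × ℕ →₀ ℕ), i ∈ hfin.toFinset ↔
      i.1 ∈ hfin.toFinset.image Prod.fst ∧ i.2 ∈ wtFinset d (n - B i.1 i.1 / 2) := by
    intro i
    have h2 : i ∈ hfin.toFinset ↔ i.2 ∈ wtFinset d (n - B i.1 i.1 / 2) := by
      rw [Set.Finite.mem_toFinset, Set.mem_ofPred_eq, totalWeight, mem_wtFinset]
      omega
    exact ⟨fun hi => ⟨Finset.mem_image_of_mem _ hi, h2.1 hi⟩, fun hi => h2.2 hi.2⟩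
  rw [Finset.sum_finset_product _ _ (fun α => wtFinset d (n - B α α / 2)) hprod,
    Finset.sum_finset_product _ _ (fun α => wtFinset d (n - B α α / 2)) hprod]
  refine Finset.sum_congr rfl fun α _ => ?_
  dsimp only
  rw [Finset.sum_const, nsmul_eq_mul, mul_comm, ← blockTrace_zeroMode B h hε hP hΔ,
    blockTrace_apply]
  refine Finset.sum_congr rfl fun μ _ => ?_
  rw [spaceBasis_repr, spaceBasis_apply]
  rfl

end TraceFunction

end LatticeVOA

open LatticeVOA in
theorem theorem3 {L : Type*} [AddCommGroup L] [Module.Free ℤ L] [Module.Finite ℤ L]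
    (B : LinearMap.BilinForm ℤ L) (hB : IsPosDefEven B)
    (ε : L → L → ℤˣ) (hε : IsCocycle B ε)
    {d : ℕ} (hd : Module.finrank ℤ L = d)
    (h : Module.Basis (Fin d) ℂ (ℂ ⊗[ℤ] L))
    (hh : ∀ i j, B.baseChange ℂ (h i) (h j) = if i = j then 1 else 0)
    (k : ℕ) (P : MvPolynomial (Fin d) ℂ) (hP : P.IsHomogeneous k)
    (hΔ : ∑ i, MvPolynomial.pderiv i (MvPolynomial.pderiv i P) = 0) :
    IsPrimary B ε h k (vec L P) ∧
    (∀ τ : ℍ, Summable (thetaTerm B h P τ)) ∧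
    HasTraceFunction B ε h k (vec L P)
      (fun τ => theta B h P τ / ModularForm.eta (τ : ℂ) ^ d) := by
  have hε0 := hε.zero_left
  have hfin := finite_totalWeight_eq (d := d) hB
  refine ⟨⟨?_, fun n hn => virasoro_pos_vec B h hε0 hΔ hn⟩, summable_thetaTerm h hB P,
    fun n => finiteDimensional_eigenspace (spaceBasis L d)
      (virasoro_zero_spaceBasis h hB hε0 hh) n (hfin n),
    zeroMode_mem_weightSpace h hB hε0 hh hP, fun τ => ?_⟩
  · have h1 := virasoro_zero_of_mem_block_lattice h hB hε0 hh (vec_mem_block L hP)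
    rw [map_zero, Int.zero_ediv, zero_add] at h1
    exact Module.End.mem_eigenspace_iff.2 h1
  · -- sum the double series along the fibres of the weight
    have h1 := ((Equiv.sigmaFiberEquiv (totalWeight (d := d) B)).hasSum_iff).2
      (hasSum_traceTerm hB h P τ)
    have h2 := h1.sigma (g := fun n => ∑ i ∈ (hfin n).toFinset, traceTerm B h P τ i) fun n => by
      have : Fintype {i // totalWeight (d := d) B i = n} := (hfin n).fintype
      rw [Finset.sum_subtype (hfin n).toFinset (p := fun i => totalWeight B i = n)
        fun i => (hfin n).mem_toFinset]
      exact hasSum_fintype _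
    have h3 := h2.mul_left ((Complex.exp (2 * Real.pi * Complex.I * (τ : ℂ) / 24) ^ d)⁻¹)
    have heta : ModularForm.eta (τ : ℂ) = Complex.exp (2 * Real.pi * Complex.I * (τ : ℂ) / 24) *
        ∏' n : ℕ, (1 - Complex.exp (2 * Real.pi * Complex.I * (τ : ℂ)) ^ (n + 1)) := by
      simp only [ModularForm.eta, ModularForm.eta_q_eq_pow]
      simp [Function.Periodic.qParam]
    have hval : theta B h P τ / ModularForm.eta (τ : ℂ) ^ d =
        (Complex.exp (2 * Real.pi * Complex.I * (τ : ℂ) / 24) ^ d)⁻¹ * (theta B h P τ *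
        ((∏' n : ℕ, (1 - Complex.exp (2 * Real.pi * Complex.I * (τ : ℂ)) ^ (n + 1)))⁻¹) ^ d) := by
      rw [heta, mul_pow, inv_pow, div_eq_mul_inv, mul_inv]
      ring
    change HasSum _ (theta B h P τ / ModularForm.eta (τ : ℂ) ^ d)
    rw [hval]
    have hfun : ∀ n : ℤ, LinearMap.trace ℂ (weightSpace B ε h n)
        ((zeroMode B ε h k (vec L P)).restrict (zeroMode_mem_weightSpace h hB hε0 hh hP n)) *
          Complex.exp (2 * Real.pi * Complex.I * (τ : ℂ) * ((n : ℂ) - (d : ℂ) / 24)) =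
        (Complex.exp (2 * Real.pi * Complex.I * (τ : ℂ) / 24) ^ d)⁻¹ *
          ∑ i ∈ (hfin n).toFinset, traceTerm B h P τ i := by
      intro n
      rw [trace_zeroMode h hB hε0 hh hP hΔ n (hfin n), Finset.sum_mul, Finset.mul_sum]
      refine Finset.sum_congr rfl fun i hi => ?_
      rw [traceTerm, show totalWeight B i = n from (hfin n).mem_toFinset.1 hi,
        ← Complex.exp_nat_mul, ← Complex.exp_neg, mul_left_comm, ← Complex.exp_add]
      congr 2
      ring
    simp only [hfun]
    exact h3
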